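/- Let $b\ge p\ge 1$ and $d_{\mathrm{in}},d_{\mathrm{out}}\ge 1$ be integers. The random bipartite gadget $B=(V_B,E_B)\sim\mathcal G(b,p,d_{\mathrm{in}},d_{\mathrm{out}})$ is the following graph. Its vertex set is $V_B=L\cup R$ with $|L|=|R|=b$, $L\cap R=\emptyset$; a set of ports $P\subseteq V_B$ is chosen uniformly at random among the sets with $|P\cap L|=|P\cap R|=p$; given $P$, one draws $d_{\mathrm{in}}$ uniform perfect matchings between $L$ and $R$ and $d_{\mathrm{out}}$ uniform perfect matchings between $L\setminus P$ and $R\setminus P$, all independent; $E_B$ is the union of these matchings, with multiple edges replaced by single edges. A host model of $B$ with parameters $q\in\mathbb N$, $q\ge1$, $\beta_B>0$, $h\in\mathbb R$, $\kappa\in[q]$ consists of a finite simple graph $\mathbb B=(V_{\mathbb B},E_{\mathbb B})$ containing $B$ as an induced subgraph, with $\partial P:=V_{\mathbb B}\setminus V_B$, such that every vertex of $P$ has at most $d_{\mathrm{out}}$ neighbours in $\partial P$ and there are no edges between $V_B\setminus P$ and $\partial P$, together with edge interactions $\beta_{\mathbb B}:E_{\mathbb B}\to\mathbb R$ such that $\beta_{\mathbb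 B}(e)=\beta_B$ for $e\in E_B$ and $|\beta_{\mathbb B}(e)|\le\beta_B$ for $e\in E_{\mathbb B}\setminus E_B$, and with the external field $h_{\mathbb B}(v,i)=h\,\mathbf 1(i=\kappa)\,\mathbf 1(v\in V_B)$. Its Gibbs distribution $\mu_{\mathbb B}$ on $[q]^{V_{\mathbb B}}$ gives $\sigma$ a probability proportional to $\exp\big[\sum_{\{u,v\}\in E_{\mathbb B}}\beta_{\mathbb B}(\{u,v\})\mathbf 1(\sigma(u)=\sigma(v))+\sum_{v\in V_{\mathbb B}}h_{\mathbb B}(v,\sigma(v))\big]$. Let $\sigma^i(B)$ denote the configuration of $V_B$ in which every vertex has spin $i$, and $\{\partial P=\tau\}$ the event that the configuration on $\partial P$ is $\tau\in[q]^{\partial P}$. **Theorem.** Let $\alpha\in(0,\frac14]$ and let $D$ be an integer. There is a constant $\delta=\delta(\alpha,D)>0$ such that, for every integer sequence $d=d(b)$ with $3\le d\le D$, setting $d_{\mathrm{in}}=d-1$, $d_{\mathrm{out}}=1$ and $p=\lfloor b^\alpha\rfloor$, the following holds with probability $1-o(1)$ as $b\to\infty$ over the choice of $B\sim\mathcal G(b,p,d_{\mathrm{in}},d_{\mathrm{out}})$: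 for all $q\ge 1$, $\beta_B>0$, $h\in\mathbb R$, $\kappa\in[q]$, every host model of $B$ with these parameters, and every configuration $\tau\in[q]^{\partial P}$, $$\mu_{\mathbb B}\Big(\bigcup_{i\in[q]}\{\sigma^i(B)\}\ \Big|\ \partial P=\tau\Big)\ \ge\ \max\Big\{0,\ 1-\frac{q^2e^{2|h|}}{e^{\delta\beta_B d}}\Big\}^{2b}.$$ -/

import Mathlib

open Filter Topology

noncomputable section

/-- A `q`-state Potts model on the vertex set `V`: a simple graph, an interaction for every edge
and an external field. Only the values of `edgeWeight` on edges of the graph are ever used. -/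
structure PottsModel (V : Type) (q : ℕ) where
  graph : SimpleGraph V
  edgeWeight : Sym2 V → ℝ
  field : V → Fin q → ℝ

namespace PottsModel

variable {V : Type} [Fintype V] {q : ℕ}

open Classical in
/-- The weight of `σ`: the exponential of the total interaction of the edges whose endpoints have
the same spin, plus the total field. -/
def weight (M : PottsModel V q) (σ : V → Fin q) : ℝ :=
  Real.exp ((∑ e ∈ M.graph.edgeFinset with (Sym2.map σ e).IsDiag, M.edgeWeight e)
    + ∑ v, M.field v (σ v))

open Classical in
/-- The partition function restricted to a set of configurations. -/
def partitionOn (M : PottsModel V q) (A : Set (V → Fin q)) : ℝ :=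
  ∑ σ : V → Fin q with σ ∈ A, M.weight σ

/-- The Gibbs probability of a set of configurations. -/
def gibbs (M : PottsModel V q) (A : Set (V → Fin q)) : ℝ :=
  M.partitionOn A / M.partitionOn Set.univ

/-- The conditional Gibbs probability of `A` given `C`. -/
def condGibbs (M : PottsModel V q) (A C : Set (V → Fin q)) : ℝ :=
  M.gibbs (A ∩ C) / M.gibbs C

end PottsModel

/-- The vertices of the gadget: `Sum.inl` is the side `L`, `Sum.inr` the side `R`. -/
abbrev GadgetVertex (b : ℕ) : Type := Fin b ⊕ Fin b

/-- The possible sets of ports: `p` vertices of each side. -/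
abbrev PortSet (b p : ℕ) : Type :=
  {P : Finset (GadgetVertex b) //
    (P.filter (fun x => x.isLeft = true)).card = p ∧
    (P.filter (fun x => x.isRight = true)).card = p}

/-- The sample space of the random gadget: a set of ports, `dIn` perfect matchings between the
two sides, and `dOut` perfect matchings between the non-ports of the two sides. Every port set
admits equally many families of matchings, so that a uniform element of this finite type has a
uniform port set and, given the ports, independent uniform perfect matchings. -/
abbrev GadgetSample (b p dIn dOut : ℕ) : Type :=
  Σ P : PortSet b p, (Fin dIn → (Fin b ≃ Fin b)) ×
    (Fin dOut → ({u : Fin b // Sum.inl u ∉ P.1} ≃ {v : Fin b // Sum.inr v ∉ P.1}))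

namespace GadgetSample

variable {b p dIn dOut : ℕ}

/-- The ports of the gadget. -/
def ports (ω : GadgetSample b p dIn dOut) : Finset (GadgetVertex b) := ω.1.1

/-- The gadget: the union of all the matchings, as a simple graph (multiple edges merged). -/
def graph (ω : GadgetSample b p dIn dOut) : SimpleGraph (GadgetVertex b) :=
  SimpleGraph.fromRel fun x y => ∃ u v : Fin b, x = Sum.inl u ∧ y = Sum.inr v ∧
    ((∃ i, ω.2.1 i u = v) ∨ ∃ i, ∃ hu : Sum.inl u ∉ ω.1.1, (ω.2.2 i ⟨u, hu⟩ : Fin b) = v)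

end GadgetSample

/-- The probability of an event over the random gadget (uniform on the sample space). -/
def gadgetProb (b p dIn dOut : ℕ) (E : Set (GadgetSample b p dIn dOut)) : ℝ :=
  (Nat.card E : ℝ) / (Nat.card (GadgetSample b p dIn dOut) : ℝ)

/-- `G` is a host graph of the gadget `B` with ports `P` and outside vertices `W`: `B` is the
subgraph that `G` induces on the gadget vertices, every port has at most `dOut` neighbours outside
the gadget, and the other gadget vertices have none. Edges inside `W` are arbitrary. -/
structure IsHostGraph {V W : Type} (B : SimpleGraph V) (P : Finset V) (dOut : ℕ)
    (G : SimpleGraph (V ⊕ W)) : Prop where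
  induced : ∀ x y : V, G.Adj (Sum.inl x) (Sum.inl y) ↔ B.Adj x y
  port_degree : ∀ x ∈ P, {w : W | G.Adj (Sum.inl x) (Sum.inr w)}.ncard ≤ dOut
  nonport : ∀ x ∉ P, ∀ w : W, ¬ G.Adj (Sum.inl x) (Sum.inr w)

/-- `M` is a Potts model on a host graph of the gadget `B` with ports `P`: every edge of `B` has
interaction `βB`, all other edges have interaction at most `βB` in absolute value, and the field is
`h` for the spin `κ` at the gadget vertices and `0` otherwise. -/
structure IsHostModel {V W : Type} {q : ℕ} (B : SimpleGraph V) (P : Finset V) (dOut : ℕ)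
    (βB h : ℝ) (κ : Fin q) (M : PottsModel (V ⊕ W) q) : Prop where
  host : IsHostGraph B P dOut M.graph
  inner_weight : ∀ e ∈ B.edgeSet, M.edgeWeight (Sym2.map Sum.inl e) = βB
  outer_weight : ∀ e ∈ M.graph.edgeSet, e ∉ Sym2.map Sum.inl '' B.edgeSet → |M.edgeWeight e| ≤ βB
  field_gadget : ∀ x i, M.field (Sum.inl x) i = if i = κ then h else 0
  field_outside : ∀ w i, M.field (Sum.inr w) i = 0

end

/-!
The gadget dominates its boundary because it expands: with high probability every set `S` of at
most half of its vertices satisfies `|∂S| ≥ |S ∩ P| + c |S|` with an absolute constant `c`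
(`IsPortExpander`). A port has at most one edge to the outside, of interaction at most `βB`, so that
changing the spins on `S` gains at most `βB |S ∩ P|` outside the gadget and at most `|h| |S|` from
the field, while it costs `βB |∂S|` inside. Comparing every configuration with the constant one of
its most frequent spin and summing over configurations (`IsHostModel.condGibbs_ge`) gives
`Z ≤ Z_const (1 + (q - 1) exp (|h| - c βB / 4)) ^ (2b)`, which suffices because
`(1 - x) (1 + x) ≤ 1`. As `d` is bounded, a constant surplus per vertex is as good as one
proportional to `d`.

More edges only help the expansion, so only two full matchings `π₀`, `π₁` and the matching `ρ`
between the non-ports are used, and all estimates hold conditionally on the set of ports. Two events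
suffice (`isPortExpander_of_areMixing`).

* Ports are far apart on the alternating cycles of `π₀` and `π₁` (`ArePortsSeparated`). Each port
  then starts two paths of some large constant length, all of them disjoint; a path from a port
  in `S` either leaves `S` or has all its vertices in `S`, whence `|∂S| ≥ 2 |S ∩ P| - |S| / K`
  (`two_mul_card_inter_le`). The event fails with probability `O(p² / b)`, by redirecting the last
  step of a walk that hits a port (`card_first_hit_mul_le`).
* No `S` is almost perfectly matched within itself by all three matchings (`AreMixing`), so that
  `|∂S| ≥ ε |S| - |S ∩ P|`, where the ports appear because `ρ` misses them. This is a union bound: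
  for `|S| = s`, each matching contributes a factor of about `1 / b.choose (s / 2)`, and two of the
  three factors compensate the choice of `S` (`choose_mul_card_matchedTriples_le`,
  `choose_mul_choose_sq_le`). The remaining one makes the sum over `s` of order `1 / b`.

Adding the second bound to twice the first shows that `|∂S| - |S ∩ P|` is at least a positive
multiple of `|S|`.
-/

/-! ### Cuts and spin configurations -/

open Classical in
/-- The edges of `G` leaving the vertex set `S`, oriented outwards: each cut edge is counted once,
as the pair of its endpoint inside `S` and its endpoint outside `S`. -/
noncomputable def cutPairs {V : Type} [Fintype V] (G : SimpleGraph V) (S : Finset V) :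
    Finset (V × V) :=
  Finset.univ.filter fun z => z.1 ∈ S ∧ z.2 ∉ S ∧ G.Adj z.1 z.2

open Classical in
/-- The edges of `G` whose endpoints receive different values under `σ`. -/
noncomputable def bichromaticEdges {V : Type} [Fintype V] {q : ℕ} (G : SimpleGraph V)
    (σ : V → Fin q) : Finset (Sym2 V) :=
  G.edgeFinset.filter fun e => ¬ (Sym2.map σ e).IsDiag

open Classical in
theorem card_cutPairs_le_card_bichromaticEdges {V : Type} [Fintype V] {q : ℕ}
    (G : SimpleGraph V) (σ : V → Fin q) (i : Fin q) :
    (cutPairs G (Finset.univ.filter fun x => σ x ≠ i)).card ≤ (bichromaticEdges G σ).card := by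
  apply Finset.card_le_card_of_injOn (fun z => s(z.1, z.2))
  · rintro ⟨x, y⟩ h
    simp only [cutPairs, Finset.coe_filter, Finset.mem_univ, true_and, Finset.mem_filter,
      Set.mem_ofPred_eq, not_not] at h
    simp only [bichromaticEdges, Finset.coe_filter, SimpleGraph.mem_edgeFinset,
      SimpleGraph.mem_edgeSet, Set.mem_ofPred_eq, Sym2.map_mk, Sym2.mk_isDiag_iff]
    exact ⟨h.2.2, fun h' => h.1 (h'.trans h.2.1)⟩
  · rintro ⟨x, y⟩ h ⟨x', y'⟩ h' hxy
    simp only [cutPairs, Finset.coe_filter, Finset.mem_univ, true_and, Finset.mem_filter,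
      Set.mem_ofPred_eq, not_not] at h h'
    simp only [Sym2.eq_iff] at hxy
    rcases hxy with ⟨rfl, rfl⟩ | ⟨rfl, rfl⟩
    · rfl
    · exact absurd h'.2.1 h.1

open Classical in
theorem sum_card_cutPairs_le_two_mul_card_bichromaticEdges {V : Type} [Fintype V] {q : ℕ}
    (G : SimpleGraph V) (σ : V → Fin q) :
    ∑ j, (cutPairs G (Finset.univ.filter fun x => σ x = j)).card
      ≤ 2 * (bichromaticEdges G σ).card := by
  have hdisj : ∀ j ∈ (Finset.univ : Finset (Fin q)), ∀ k ∈ (Finset.univ : Finset (Fin q)), j ≠ k →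
      Disjoint (cutPairs G (Finset.univ.filter fun x => σ x = j))
        (cutPairs G (Finset.univ.filter fun x => σ x = k)) := by
    intro j _ k _ hjk
    rw [Finset.disjoint_left]
    intro z hz hz'
    simp only [cutPairs, Finset.mem_univ, true_and, Finset.mem_filter] at hz hz'
    exact hjk (hz.1.symm.trans hz'.1)
  rw [← Finset.card_biUnion hdisj]
  set T := Finset.univ.biUnion fun j => cutPairs G (Finset.univ.filter fun x => σ x = j)
  have hT : ∀ z ∈ T, σ z.1 ≠ σ z.2 ∧ G.Adj z.1 z.2 := by
    intro z hz
    simp only [T, cutPairs, Finset.mem_biUnion, Finset.mem_univ, true_and, Finset.mem_filter] at hz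
    obtain ⟨j, h1, h2, h3⟩ := hz
    exact ⟨fun h => h2 (h.symm.trans h1), h3⟩
  calc T.card ≤ 2 * (T.image fun z => s(z.1, z.2)).card := by
        apply Finset.card_le_mul_card_image
        intro e _
        induction e with | _ x y =>
        calc _ ≤ ({(x, y), (y, x)} : Finset (V × V)).card := by
              apply Finset.card_le_card
              rintro ⟨x', y'⟩ h
              simp only [Finset.mem_filter, Sym2.eq_iff] at h
              simpa using h.2
          _ ≤ 2 := Finset.card_le_two
    _ ≤ 2 * (bichromaticEdges G σ).card := by
        gcongr
        intro e he
        simp only [Finset.mem_image] at he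
        obtain ⟨z, hz, rfl⟩ := he
        simp only [bichromaticEdges, Finset.mem_filter, SimpleGraph.mem_edgeFinset,
          SimpleGraph.mem_edgeSet, Sym2.map_mk, Sym2.mk_isDiag_iff]
        exact ⟨(hT z hz).2, (hT z hz).1⟩

open Classical in
/-- The edge expansion that the gadget needs: a set of at most half of the vertices is left by more
edges than it has ports, with a surplus proportional to its size. -/
def IsPortExpander {V : Type} [Fintype V] [DecidableEq V] (G : SimpleGraph V)
    (P : Finset V) (c : ℝ) : Prop :=
  ∀ S : Finset V, 2 * S.card ≤ Fintype.card V →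
    ((S ∩ P).card : ℝ) + c * S.card ≤ (cutPairs G S).card

open Classical in
/-- If the most frequent spin `i` is taken by fewer than half of the vertices, every spin class is
small enough for the expansion to apply, and the few ports are negligible against the total. -/
theorem IsPortExpander.exists_spin {V : Type} [Fintype V] [DecidableEq V] {q : ℕ}
    {G : SimpleGraph V} {P : Finset V} {c : ℝ} (hG : IsPortExpander G P c) (hc : 0 ≤ c)
    (hP : 4 * (P.card : ℝ) ≤ c * Fintype.card V) (κ : Fin q) (σ : V → Fin q) :
    ∃ i, (((Finset.univ.filter fun x => σ x ≠ i) ∩ P).card : ℝ)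
      + c / 4 * (Finset.univ.filter fun x => σ x ≠ i).card ≤ (bichromaticEdges G σ).card := by
  obtain ⟨i, -, hi⟩ := Finset.exists_max_image Finset.univ
    (fun j => (Finset.univ.filter fun x => σ x = j).card) ⟨κ, Finset.mem_univ κ⟩
  refine ⟨i, ?_⟩
  set S := Finset.univ.filter fun x => σ x ≠ i with hS
  have hsum : (Finset.univ.filter fun x => σ x = i).card + S.card = Fintype.card V :=
    Finset.card_filter_add_card_filter_not _
  by_cases h : 2 * S.card ≤ Fintype.card V
  · have h1 := hG S h
    have h2 : ((cutPairs G S).card : ℝ) ≤ (bichromaticEdges G σ).card := by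
      exact_mod_cast card_cutPairs_le_card_bichromaticEdges G σ i
    have h3 : c / 4 * (S.card : ℝ) ≤ c * S.card := by gcongr; linarith
    linarith
  · have hsmall : ∀ j, 2 * (Finset.univ.filter fun x => σ x = j).card ≤ Fintype.card V := by
      intro j
      have := hi j (Finset.mem_univ j)
      omega
    have h1 : ∀ j, c * ((Finset.univ.filter fun x => σ x = j).card : ℝ)
        ≤ (cutPairs G (Finset.univ.filter fun x => σ x = j)).card := by
      intro j
      have := hG _ (hsmall j)
      have h0 : (0 : ℝ) ≤ (((Finset.univ.filter fun x => σ x = j) ∩ P).card : ℝ) := by positivity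
      linarith
    have h2 : ∑ j, ((Finset.univ.filter fun x => σ x = j).card : ℝ) = Fintype.card V := by
      rw [← Finset.card_univ, Finset.card_eq_sum_card_fiberwise (f := σ) (t := Finset.univ)]
      · push_cast; rfl
      · intro x _; simp
    have h3 : c * Fintype.card V ≤ 2 * (bichromaticEdges G σ).card := by
      rw [← h2, Finset.mul_sum]
      refine (Finset.sum_le_sum fun j _ => h1 j).trans ?_
      exact_mod_cast sum_card_cutPairs_le_two_mul_card_bichromaticEdges G σ
    have h4 : ((S ∩ P).card : ℝ) ≤ P.card := by
      exact_mod_cast Finset.card_le_card Finset.inter_subset_right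
    have h5 : c / 4 * (S.card : ℝ) ≤ c / 4 * Fintype.card V := by
      gcongr
      exact Finset.card_le_univ S
    linarith

/-! ### Host models on expanding gadgets -/

theorem PottsModel.weight_pos {V : Type} [Fintype V] {q : ℕ} (M : PottsModel V q)
    (σ : V → Fin q) : 0 < M.weight σ := Real.exp_pos _

open Classical in
/-- Giving spin `i` to all gadget vertices gains the bichromatic edges. It loses at most one outer
edge at each port whose spin changes, since a port has only one neighbour outside the gadget. -/
theorem IsHostModel.weight_le {V W : Type} [Fintype V] [DecidableEq V] [Fintype W] {q : ℕ}
    {B : SimpleGraph V} {P : Finset V} {β h : ℝ} {κ : Fin q} {M : PottsModel (V ⊕ W) q} (hβ : 0 < β)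
    (hM : IsHostModel B P 1 β h κ M) (σ : V → Fin q) (τ : W → Fin q) (i : Fin q) :
    M.weight (Sum.elim σ τ) ≤ M.weight (Sum.elim (fun _ => i) τ) *
      Real.exp (-β * (bichromaticEdges B σ).card
        + β * ((Finset.univ.filter fun x => σ x ≠ i) ∩ P).card
        + |h| * (Finset.univ.filter fun x => σ x ≠ i).card) := by
  set S := Finset.univ.filter fun x => σ x ≠ i with hS
  have hmem : ∀ x, x ∈ S ↔ σ x ≠ i := by simp [hS]
  unfold PottsModel.weight
  rw [← Real.exp_add]
  apply Real.exp_le_exp.mpr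
  have hfield : ∑ v, M.field v (Sum.elim σ τ v) - ∑ v, M.field v (Sum.elim (fun _ => i) τ v)
      ≤ |h| * S.card := by
    rw [← Finset.sum_sub_distrib, Fintype.sum_sum_type]
    simp only [Sum.elim_inl, Sum.elim_inr, sub_self, Finset.sum_const_zero, add_zero]
    calc _ ≤ ∑ x, if x ∈ S then |h| else 0 := by
          apply Finset.sum_le_sum
          intro x _
          rw [hM.field_gadget, hM.field_gadget]
          have h1 := le_abs_self h
          have h2 := neg_abs_le h
          have h3 := abs_nonneg h
          by_cases hx : σ x = i
          · simp [hmem, hx]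
          · rw [if_pos ((hmem x).2 hx)]
            split_ifs <;> linarith
      _ = |h| * S.card := by
          rw [Finset.sum_ite_mem, Finset.univ_inter, Finset.sum_const, nsmul_eq_mul, mul_comm]
  have hinj : Function.Injective (Sym2.map (Sum.inl : V → V ⊕ W)) :=
    Sym2.map.injective Sum.inl_injective
  -- the outer edges on which the two configurations can differ
  set T : Finset (Sym2 (V ⊕ W)) := (S ∩ P).biUnion fun x =>
    (Finset.univ.filter fun w => M.graph.Adj (Sum.inl x) (Sum.inr w)).image
      fun w => s(Sum.inl x, Sum.inr w) with hT
  have hTcard : T.card ≤ (S ∩ P).card := by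
    refine Finset.card_biUnion_le.trans ?_
    rw [Finset.card_eq_sum_ones]
    apply Finset.sum_le_sum
    intro x hx
    refine Finset.card_image_le.trans ?_
    have := hM.host.port_degree x (Finset.mem_inter.1 hx).2
    rwa [Set.ncard_eq_toFinset_card', Set.toFinset_ofPred] at this
  have hedge : ∀ e ∈ M.graph.edgeFinset,
      (if (Sym2.map (Sum.elim σ τ) e).IsDiag then M.edgeWeight e else 0)
        - (if (Sym2.map (Sum.elim (fun _ => i) τ) e).IsDiag then M.edgeWeight e else 0)
      ≤ (if e ∈ (bichromaticEdges B σ).image (Sym2.map Sum.inl) then -β else 0)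
        + (if e ∈ T then β else 0) := by
    intro e he
    rw [SimpleGraph.mem_edgeFinset] at he
    have houter := hM.outer_weight e he
    induction e with | _ a c =>
    rw [SimpleGraph.mem_edgeSet] at he
    have hTnn : (0 : ℝ) ≤ if s(a, c) ∈ T then β else 0 := by split_ifs <;> linarith
    -- an edge between the gadget and the outside, up to its orientation
    have hcross : ∀ (x : V) (w : W), M.graph.Adj (Sum.inl x) (Sum.inr w) →
        s(a, c) = s(Sum.inl x, Sum.inr w) →
        (if (Sym2.map (Sum.elim σ τ) s(a, c)).IsDiag then M.edgeWeight s(a, c) else 0)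
          - (if (Sym2.map (Sum.elim (fun _ => i) τ) s(a, c)).IsDiag then
              M.edgeWeight s(a, c) else 0)
        ≤ (if s(a, c) ∈ (bichromaticEdges B σ).image (Sym2.map Sum.inl) then -β else 0)
          + (if s(a, c) ∈ T then β else 0) := by
      intro x w hadj hxw
      rw [hxw] at houter ⊢
      have hni : ∀ e' : Sym2 V, Sym2.map (Sum.inl : V → V ⊕ W) e' ≠ s(Sum.inl x, Sum.inr w) := by
        intro e'
        induction e' with | _ y z =>
        simp
      have hnimg : s(Sum.inl x, Sum.inr w) ∉ (bichromaticEdges B σ).image (Sym2.map Sum.inl) := by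
        rw [Finset.mem_image]
        rintro ⟨e', -, h'⟩
        exact hni e' h'
      rw [if_neg hnimg]
      simp only [Sym2.map_mk, Sum.elim_inl, Sum.elim_inr, Sym2.mk_isDiag_iff, zero_add]
      by_cases hx : x ∈ S
      · have hxP : x ∈ P := by
          by_contra hxP
          exact hM.host.nonport x hxP w hadj
        have hxT : s(Sum.inl x, Sum.inr w) ∈ T := by
          simp only [hT, Finset.mem_biUnion, Finset.mem_image, Finset.mem_filter,
            Finset.mem_univ, true_and, Finset.mem_inter]
          exact ⟨x, ⟨hx, hxP⟩, w, hadj, rfl⟩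
        rw [if_pos hxT]
        have hw := abs_le.1 (houter (by rintro ⟨e', -, h'⟩; exact hni e' h'))
        have hx' := (hmem x).1 hx
        by_cases h1 : σ x = τ w
        · have h2 : i ≠ τ w := fun h2 => hx' (h1.trans h2.symm)
          simp only [h1, h2, if_true, if_false]
          linarith [hw.2]
        · by_cases h2 : i = τ w
          · rw [if_neg h1, if_pos h2]; linarith [hw.1]
          · rw [if_neg h1, if_neg h2]; linarith
      · have hx' : σ x = i := by simpa [hmem] using hx
        rw [hx', sub_self]
        split_ifs <;> linarith
    rcases a with x | w <;> rcases c with y | w'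
    · have hB : B.Adj x y := (hM.host.induced x y).1 he
      have hw : M.edgeWeight s(Sum.inl x, Sum.inl y) = β := by
        simpa using hM.inner_weight s(x, y) hB
      have himg : s((Sum.inl x : V ⊕ W), Sum.inl y) ∈
          (bichromaticEdges B σ).image (Sym2.map Sum.inl) ↔ σ x ≠ σ y := by
        rw [← Sym2.map_mk, hinj.mem_finset_image]
        simp [bichromaticEdges, hB]
      rw [hw]
      simp only [himg, Sym2.map_mk, Sum.elim_inl, Sym2.mk_isDiag_iff, if_true]
      by_cases hxy : σ x = σ y
      · simp only [hxy, ne_eq, not_true_eq_false, if_true, if_false, sub_self, zero_add]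
        exact hTnn
      · simp only [hxy, ne_eq, not_false_eq_true, if_true, if_false]
        linarith
    · exact hcross x w' he rfl
    · exact hcross y w he.symm Sym2.eq_swap
    · simp only [Sym2.map_mk, Sum.elim_inr, Sym2.mk_isDiag_iff, sub_self]
      rw [if_neg]
      · linarith
      · simp only [Finset.mem_image, not_exists, not_and]
        intro e' _
        induction e' with | _ y z =>
        simp
  have hsum := Finset.sum_le_sum hedge
  rw [Finset.sum_sub_distrib, ← Finset.sum_filter, ← Finset.sum_filter, Finset.sum_add_distrib,
    ← Finset.sum_filter, ← Finset.sum_filter, Finset.sum_const, Finset.sum_const,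
    Finset.filter_mem_eq_inter, Finset.filter_mem_eq_inter] at hsum
  have hsub : (bichromaticEdges B σ).image (Sym2.map Sum.inl) ⊆ M.graph.edgeFinset := by
    intro e he
    obtain ⟨e', he', rfl⟩ := Finset.mem_image.1 he
    induction e' with | _ x y =>
    simp only [bichromaticEdges, Finset.mem_filter, SimpleGraph.mem_edgeFinset,
      SimpleGraph.mem_edgeSet] at he'
    simpa using (hM.host.induced x y).2 he'.1
  rw [Finset.inter_eq_right.2 hsub, Finset.card_image_of_injective _ hinj] at hsum
  have hTle : ((M.graph.edgeFinset ∩ T).card : ℝ) ≤ (S ∩ P).card := by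
    exact_mod_cast (Finset.card_le_card Finset.inter_subset_right).trans hTcard
  have hTβ := mul_le_mul_of_nonneg_left hTle hβ.le
  simp only [nsmul_eq_mul] at hsum
  linarith

open Classical in
/-- The sum factorizes over the vertices: each has spin `i`, or one of the `q - 1` other spins at
the price `y`. -/
theorem sum_pow_card_ne {V : Type} [Fintype V] [DecidableEq V] {q : ℕ} (i : Fin q) (y : ℝ) :
    ∑ σ : V → Fin q, y ^ (Finset.univ.filter fun x => σ x ≠ i).card
      = (1 + (q - 1) * y) ^ Fintype.card V := by
  have h1 : ∀ σ : V → Fin q, y ^ (Finset.univ.filter fun x => σ x ≠ i).card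
      = ∏ x, if σ x = i then 1 else y := by
    intro σ
    rw [Finset.prod_ite, Finset.prod_const_one, one_mul, Finset.prod_const]
  have h2 : ∑ j : Fin q, (if j = i then 1 else y) = 1 + (q - 1) * y := by
    rw [Finset.sum_ite, Finset.sum_const, Finset.sum_const, Finset.filter_eq',
      if_pos (Finset.mem_univ i), Finset.filter_ne', Finset.card_erase_of_mem (Finset.mem_univ i)]
    have : 1 ≤ q := i.pos
    simp [Nat.cast_sub this]
  simp_rw [h1]
  rw [← Fintype.piFinset_univ, Finset.sum_prod_piFinset Finset.univ
    (fun (_ : V) j => if j = i then (1 : ℝ) else y), Finset.prod_const, h2, Finset.card_univ]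

open Classical in
/-- A Peierls argument with the most frequent spin as reference: expansion makes the weight of a
configuration decay exponentially in the number of vertices that do not have that spin. -/
theorem IsHostModel.condGibbs_ge {V W : Type} [Fintype V] [DecidableEq V] [Nonempty V]
    [Fintype W] {q : ℕ} {B : SimpleGraph V} {P : Finset V} {β h c : ℝ} {κ : Fin q}
    {M : PottsModel (V ⊕ W) q} (hβ : 0 < β) (hM : IsHostModel B P 1 β h κ M)
    (hB : IsPortExpander B P c) (hc : 0 ≤ c)
    (hP : 4 * (P.card : ℝ) ≤ c * Fintype.card V) (τ : W → Fin q) {x : ℝ}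
    (hx : q * Real.exp (|h| - β * (c / 4)) ≤ x) :
    (max 0 (1 - x)) ^ Fintype.card V ≤
      M.condGibbs {σ | ∃ i : Fin q, ∀ v, σ (Sum.inl v) = i} {σ | ∀ w, σ (Sum.inr w) = τ w} := by
  set y := Real.exp (|h| - β * (c / 4)) with hy
  have hy0 : 0 < y := Real.exp_pos _
  -- the restricted partition functions as sums over configurations of the gadget
  have hC : M.partitionOn {σ | ∀ w, σ (Sum.inr w) = τ w}
      = ∑ σ : V → Fin q, M.weight (Sum.elim σ τ) := by
    unfold PottsModel.partitionOn
    symm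
    apply Finset.sum_bij (fun σ _ => Sum.elim σ τ)
    · intro σ _; simp
    · intro σ _ σ' _ h
      funext v
      exact congrFun h (Sum.inl v)
    · intro σ hσ
      simp only [Finset.mem_filter, Finset.mem_univ, true_and, Set.mem_ofPred_eq] at hσ
      refine ⟨fun v => σ (Sum.inl v), Finset.mem_univ _, ?_⟩
      funext v
      rcases v with v | w
      · rfl
      · exact (hσ w).symm
    · intro σ _; rfl
  have hA : M.partitionOn ({σ | ∃ i : Fin q, ∀ v, σ (Sum.inl v) = i} ∩
      {σ | ∀ w, σ (Sum.inr w) = τ w}) = ∑ i : Fin q, M.weight (Sum.elim (fun _ => i) τ) := by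
    unfold PottsModel.partitionOn
    symm
    apply Finset.sum_bij (fun i _ => Sum.elim (fun _ => i) τ)
    · intro i _; simp
    · intro i _ j _ h
      exact congrFun h (Sum.inl (Classical.arbitrary V))
    · intro σ hσ
      simp only [Finset.mem_filter, Finset.mem_univ, true_and, Set.mem_inter_iff,
        Set.mem_ofPred_eq] at hσ
      obtain ⟨⟨i, hi⟩, hσ⟩ := hσ
      refine ⟨i, Finset.mem_univ _, ?_⟩
      funext v
      rcases v with v | w
      · exact (hi v).symm
      · exact (hσ w).symm
    · intro i _; rfl
  have huniv : 0 < M.partitionOn Set.univ :=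
    Finset.sum_pos (fun σ _ => M.weight_pos σ) ⟨fun _ => κ, by simp⟩
  have hCpos : 0 < ∑ σ : V → Fin q, M.weight (Sum.elim σ τ) :=
    Finset.sum_pos (fun σ _ => M.weight_pos _) ⟨fun _ => κ, Finset.mem_univ _⟩
  have hcond : M.condGibbs {σ | ∃ i : Fin q, ∀ v, σ (Sum.inl v) = i}
      {σ | ∀ w, σ (Sum.inr w) = τ w} = (∑ i : Fin q, M.weight (Sum.elim (fun _ => i) τ)) /
        ∑ σ : V → Fin q, M.weight (Sum.elim σ τ) := by
    unfold PottsModel.condGibbs PottsModel.gibbs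
    rw [hA, hC, div_div_div_cancel_right₀ huniv.ne']
  rw [hcond, le_div_iff₀ hCpos]
  have hw : ∀ σ : V → Fin q, M.weight (Sum.elim σ τ) ≤ ∑ i : Fin q,
      M.weight (Sum.elim (fun _ => i) τ) * y ^ (Finset.univ.filter fun v => σ v ≠ i).card := by
    intro σ
    obtain ⟨i, hi⟩ := hB.exists_spin hc hP κ σ
    refine le_trans ?_ (Finset.single_le_sum (fun j _ => mul_nonneg (M.weight_pos _).le
      (pow_nonneg hy0.le _)) (Finset.mem_univ i))
    refine (hM.weight_le hβ σ τ i).trans ?_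
    refine mul_le_mul_of_nonneg_left ?_ (M.weight_pos _).le
    rw [hy, ← Real.exp_nat_mul]
    apply Real.exp_le_exp.mpr
    have := mul_le_mul_of_nonneg_left hi hβ.le
    linarith
  have hsum : ∑ σ : V → Fin q, M.weight (Sum.elim σ τ) ≤
      (∑ i : Fin q, M.weight (Sum.elim (fun _ => i) τ)) * (1 + x) ^ Fintype.card V := by
    refine (Finset.sum_le_sum fun σ _ => hw σ).trans ?_
    rw [Finset.sum_comm, Finset.sum_mul]
    apply Finset.sum_le_sum
    intro i _
    rw [← Finset.mul_sum, sum_pow_card_ne]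
    have hq : (1 : ℝ) ≤ q := by exact_mod_cast i.pos
    have h1 : 0 ≤ ((q : ℝ) - 1) * y := mul_nonneg (by linarith) hy0.le
    have h2 : ((q : ℝ) - 1) * y ≤ x := by linarith
    exact mul_le_mul_of_nonneg_left (pow_le_pow_left₀ (by linarith) (by linarith) _)
      (M.weight_pos _).le
  have hApos : 0 ≤ ∑ i : Fin q, M.weight (Sum.elim (fun _ => i) τ) :=
    Finset.sum_nonneg fun i _ => (M.weight_pos _).le
  have hx0 : 0 ≤ x := le_trans (by positivity) hx
  have hmax : max 0 (1 - x) * (1 + x) ≤ 1 := by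
    rcases max_cases 0 (1 - x) with ⟨h1, _⟩ | ⟨h1, _⟩ <;> rw [h1] <;> nlinarith
  calc _ ≤ (max 0 (1 - x)) ^ Fintype.card V * ((∑ i : Fin q, M.weight (Sum.elim (fun _ => i) τ))
        * (1 + x) ^ Fintype.card V) := by gcongr
    _ = (max 0 (1 - x) * (1 + x)) ^ Fintype.card V
        * ∑ i : Fin q, M.weight (Sum.elim (fun _ => i) τ) := by rw [mul_pow]; ring
    _ ≤ 1 * ∑ i : Fin q, M.weight (Sum.elim (fun _ => i) τ) := by
        gcongr
        exact pow_le_one₀ (mul_nonneg (le_max_left _ _) (by linarith)) hmax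
    _ = _ := one_mul _

/-! ### Expansion from three matchings -/

/-- The successor map of the alternating cycles formed by the perfect matchings `π₀` and `π₁`: it
leaves the left side along `π₀` and the right side along `π₁`. -/
def alternatingStep {α : Type} (π₀ π₁ : α ≃ α) : Equiv.Perm (α ⊕ α) :=
  (Equiv.sumCongr π₀ π₁.symm).trans (Equiv.sumComm α α)

@[simp]
theorem alternatingStep_inl {α : Type} (π₀ π₁ : α ≃ α) (u : α) :
    alternatingStep π₀ π₁ (Sum.inl u) = Sum.inr (π₀ u) := rfl

@[simp]
theorem alternatingStep_inr {α : Type} (π₀ π₁ : α ≃ α) (v : α) :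
    alternatingStep π₀ π₁ (Sum.inr v) = Sum.inl (π₁.symm v) := rfl

open Classical in
/-- A perfect matching contributes to the cut of `S` every vertex it covers in `S`, except for the
two endpoints of each matching edge inside `S`. -/
theorem card_filter_add_card_filter_le_card_cutPairs {V Y Z : Type} [Fintype V]
    [DecidableEq V] [Fintype Y] [Fintype Z] (G : SimpleGraph V) (i : Y → V) (j : Z → V)
    (hi : Function.Injective i) (hij : ∀ y z, i y ≠ j z) (e : Y ≃ Z)
    (hadj : ∀ y, G.Adj (i y) (j (e y))) (S : Finset V) :
    (Finset.univ.filter fun y => i y ∈ S).card + (Finset.univ.filter fun z => j z ∈ S).card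
      ≤ (cutPairs G S).card + 2 * (Finset.univ.filter fun y => i y ∈ S ∧ j (e y) ∈ S).card := by
  have h1 : (Finset.univ.filter fun z => j z ∈ S).card
      = (Finset.univ.filter fun y => j (e y) ∈ S).card := by
    symm
    apply Finset.card_bij (fun y _ => e y)
    · intro y hy; simpa using hy
    · intro y _ y' _ h; exact e.injective h
    · intro z hz; exact ⟨e.symm z, by simpa using hz, by simp⟩
  have h2 := Finset.card_filter_add_card_filter_not
    (s := Finset.univ.filter fun y => i y ∈ S) (fun y => j (e y) ∈ S)
  have h3 := Finset.card_filter_add_card_filter_not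
    (s := Finset.univ.filter fun y => j (e y) ∈ S) (fun y => i y ∈ S)
  simp only [Finset.filter_filter] at h2 h3
  have h4 : (Finset.univ.filter fun y => j (e y) ∈ S ∧ i y ∈ S)
      = Finset.univ.filter fun y => i y ∈ S ∧ j (e y) ∈ S := by
    ext y; simp [and_comm]
  rw [h4] at h3
  have h5 : (Finset.univ.filter fun y => i y ∈ S ∧ j (e y) ∉ S).card
      + (Finset.univ.filter fun y => j (e y) ∈ S ∧ i y ∉ S).card ≤ (cutPairs G S).card := by
    rw [← Finset.card_image_of_injective (Finset.univ.filter fun y => i y ∈ S ∧ j (e y) ∉ S)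
        (f := fun y => (i y, j (e y))) (fun y y' h => hi (Prod.ext_iff.1 h).1),
      ← Finset.card_image_of_injective (Finset.univ.filter fun y => j (e y) ∈ S ∧ i y ∉ S)
        (f := fun y => (j (e y), i y)) (fun y y' h => hi (Prod.ext_iff.1 h).2),
      ← Finset.card_union_of_disjoint]
    · apply Finset.card_le_card
      intro z hz
      simp only [Finset.mem_union, Finset.mem_image, Finset.mem_filter, Finset.mem_univ,
        true_and] at hz
      simp only [cutPairs, Finset.mem_filter, Finset.mem_univ, true_and]
      rcases hz with ⟨y, hy, rfl⟩ | ⟨y, hy, rfl⟩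
      · exact ⟨hy.1, hy.2, hadj y⟩
      · exact ⟨hy.1, hy.2, (hadj y).symm⟩
    · rw [Finset.disjoint_left]
      simp only [Finset.mem_image, not_exists, not_and]
      rintro z ⟨y, -, rfl⟩ y' - h
      exact hij y (e y') (Prod.ext_iff.1 h).1.symm
  omega

open Classical in
/-- If the ports are far apart on cycles of length more than `2K`, the two paths of length `K` that
start at each port are disjoint. A path starting at a port in `S` either leaves `S`, which costs a
cut edge, or has all its `K` vertices in `S`. -/
theorem two_mul_card_inter_le {V : Type} [Fintype V] [DecidableEq V] (G : SimpleGraph V)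
    (f : Equiv.Perm V) (hadj : ∀ x, G.Adj x (f x)) (P : Finset V) (K : ℕ)
    (hsep : ∀ u ∈ P, ∀ u' ∈ P, ∀ k, 1 ≤ k → k ≤ 2 * K → (f ^ k) u ≠ u') (S : Finset V) :
    2 * (S ∩ P).card * K ≤ K * (cutPairs G S).card + S.card := by
  set bdry := Finset.univ.filter fun y => y ∉ S ∧ ∃ x ∈ S, G.Adj x y with hbdry
  have hcut : bdry.card ≤ (cutPairs G S).card := by
    apply Finset.card_le_card_of_surjOn (fun z => z.2)
    intro y hy
    simp only [hbdry, Finset.coe_filter, Finset.mem_univ, true_and, Set.mem_ofPred_eq] at hy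
    obtain ⟨hy, x, hx, hxy⟩ := hy
    exact ⟨(x, y), by simp [cutPairs, hx, hy, hxy], rfl⟩
  -- the vertex at signed distance `± (j + 1)` from the port `u`
  set φ : V × Bool → ℕ → V := fun t j =>
    (f ^ ((if t.2 then 1 else -1 : ℤ) * ((j : ℤ) + 1))) t.1 with hφ
  have hcollide : ∀ u ∈ P, ∀ u' ∈ P, ∀ m n : ℤ, -K ≤ m → m ≤ K → -K ≤ n → n ≤ K →
      (f ^ m) u = (f ^ n) u' → m = n := by
    have key : ∀ u ∈ P, ∀ u' ∈ P, ∀ m n : ℤ, -K ≤ m → m ≤ K → -K ≤ n → n ≤ K →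
        (f ^ m) u = (f ^ n) u' → ¬ n < m := by
      intro u hu u' hu' m n h1 h2 h3 h4 h hlt
      apply hsep u hu u' hu' (m - n).toNat (by omega) (by omega)
      rw [← zpow_natCast, Int.toNat_of_nonneg (by omega), sub_eq_neg_add, zpow_add,
        Equiv.Perm.mul_apply, h, ← Equiv.Perm.mul_apply, ← zpow_add]
      simp
    intro u hu u' hu' m n h1 h2 h3 h4 h
    have := key u hu u' hu' m n h1 h2 h3 h4 h
    have := key u' hu' u hu n m h3 h4 h1 h2 h.symm
    omega
  have hφinj : ∀ t ∈ (S ∩ P) ×ˢ (Finset.univ : Finset Bool),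
      ∀ t' ∈ (S ∩ P) ×ˢ (Finset.univ : Finset Bool), ∀ j < K, ∀ j' < K,
        φ t j = φ t' j' → t = t' ∧ j = j' := by
    rintro ⟨u, s⟩ ht ⟨u', s'⟩ ht' j hj j' hj' h
    simp only [Finset.mem_product, Finset.mem_inter, Finset.mem_univ, and_true] at ht ht'
    have h' := h
    simp only [hφ] at h
    have h1 := hcollide u ht.2 u' ht'.2 _ _ (by split_ifs <;> omega) (by split_ifs <;> omega)
      (by split_ifs <;> omega) (by split_ifs <;> omega) h
    have h2 : s = s' ∧ j = j' := by
      cases s <;> cases s' <;> simp at h1 ⊢ <;> omega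
    rw [h1] at h
    obtain ⟨rfl, rfl⟩ := h2
    exact ⟨by rw [(f ^ _).injective h], rfl⟩
  set branch : V × Bool → Finset V := fun t => (Finset.range K).image (φ t) with hbranch
  have hcard : ∀ t ∈ (S ∩ P) ×ˢ (Finset.univ : Finset Bool), (branch t).card = K := by
    intro t ht
    rw [hbranch, Finset.card_image_of_injOn, Finset.card_range]
    intro j hj j' hj' h
    exact (hφinj t ht t ht j (by simpa using hj) j' (by simpa using hj') h).2
  have hdisj : ∀ t ∈ (S ∩ P) ×ˢ (Finset.univ : Finset Bool),
      ∀ t' ∈ (S ∩ P) ×ˢ (Finset.univ : Finset Bool), t ≠ t' →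
        Disjoint (branch t) (branch t') := by
    intro t ht t' ht' hne
    rw [Finset.disjoint_left]
    intro x hx hx'
    obtain ⟨j, hj, rfl⟩ := Finset.mem_image.1 hx
    obtain ⟨j', hj', h⟩ := Finset.mem_image.1 hx'
    exact hne (hφinj t ht t' ht' j (by simpa using hj) j' (by simpa using hj') h.symm).1
  have hstep : ∀ t : V × Bool, ∀ j, G.Adj (φ t j) (φ t (j + 1)) := by
    rintro ⟨u, s⟩ j
    cases s
    · have h := hadj ((f ^ (-1 * ((j : ℤ) + 1 + 1))) u)
      have e : f ((f ^ (-1 * ((j : ℤ) + 1 + 1))) u) = (f ^ (-1 * ((j : ℤ) + 1))) u := by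
        rw [← Equiv.Perm.mul_apply, ← zpow_one_add]
        congr 2
      rw [e] at h
      simpa [hφ] using h.symm
    · have h := hadj ((f ^ (1 * ((j : ℤ) + 1))) u)
      rw [← Equiv.Perm.mul_apply, ← zpow_one_add, add_comm 1 (1 * _)] at h
      simpa [hφ] using h
  have hstart : ∀ t : V × Bool, G.Adj t.1 (φ t 0) := by
    rintro ⟨u, s⟩
    cases s
    · have h := hadj (f⁻¹ u)
      simpa [hφ] using h.symm
    · simpa [hφ] using hadj u
  have hlocal : ∀ t ∈ (S ∩ P) ×ˢ (Finset.univ : Finset Bool),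
      K ≤ K * (bdry ∩ branch t).card + (S ∩ branch t).card := by
    intro t ht
    have htS : t.1 ∈ S := (Finset.mem_inter.1 (Finset.mem_product.1 ht).1).1
    by_cases hall : ∀ j < K, φ t j ∈ S
    · have : S ∩ branch t = branch t := by
        apply Finset.inter_eq_right.2
        intro x hx
        obtain ⟨j, hj, rfl⟩ := Finset.mem_image.1 hx
        exact hall j (by simpa using hj)
      rw [this, hcard t ht]
      omega
    · push Not at hall
      -- the first exit from `S` along the path
      have hmin := Nat.find_spec hall
      have hprev := fun j => Nat.find_min (m := j) hall
      set j := Nat.find hall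
      have hpos : 0 < (bdry ∩ branch t).card := by
        apply Finset.card_pos.2
        refine ⟨φ t j, Finset.mem_inter.2 ⟨?_, Finset.mem_image.2 ⟨j, by simpa using hmin.1, rfl⟩⟩⟩
        simp only [hbdry, Finset.mem_filter, Finset.mem_univ, true_and]
        refine ⟨hmin.2, ?_⟩
        rcases Nat.eq_zero_or_pos j with h0 | h0
        · rw [h0]; exact ⟨t.1, htS, hstart t⟩
        · obtain ⟨j', hj'⟩ : ∃ j', j = j' + 1 := ⟨j - 1, by omega⟩
          have h1 := hprev j' (by omega)
          push Not at h1
          rw [hj']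
          exact ⟨φ t j', h1 (by omega), hstep t j'⟩
      nlinarith
  have hsum := Finset.sum_le_sum hlocal
  rw [Finset.sum_add_distrib, ← Finset.mul_sum, Finset.sum_const, Finset.card_product,
    ← Finset.card_biUnion (fun t ht t' ht' hne => (hdisj t ht t' ht' hne).mono
      Finset.inter_subset_right Finset.inter_subset_right),
    ← Finset.card_biUnion (fun t ht t' ht' hne => (hdisj t ht t' ht' hne).mono
      Finset.inter_subset_right Finset.inter_subset_right)] at hsum
  have h1 : (((S ∩ P) ×ˢ (Finset.univ : Finset Bool)).biUnion fun t => bdry ∩ branch t).card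
      ≤ (cutPairs G S).card :=
    (Finset.card_le_card (Finset.biUnion_subset.2 fun t _ => Finset.inter_subset_left)).trans hcut
  have h2 : (((S ∩ P) ×ˢ (Finset.univ : Finset Bool)).biUnion fun t => S ∩ branch t).card
      ≤ S.card :=
    Finset.card_le_card (Finset.biUnion_subset.2 fun t _ => Finset.inter_subset_left)
  simp only [Finset.card_univ, Fintype.card_bool, smul_eq_mul] at hsum
  have h3 := Nat.mul_le_mul_left K h1
  linarith

/-- The number of edges of the matching `e` that join a vertex of `A` to a vertex of `C`. -/
def matchedCard {α β : Type} [DecidableEq β] (e : α ≃ β) (A : Finset α) (C : Finset β) : ℕ :=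
  (A.filter fun u => e u ∈ C).card

/-- The vertices of the left side that are not ports. -/
abbrev LeftNonports {b : ℕ} (P : Finset (GadgetVertex b)) : Type := {u : Fin b // Sum.inl u ∉ P}

/-- The vertices of the right side that are not ports. -/
abbrev RightNonports {b : ℕ} (P : Finset (GadgetVertex b)) : Type := {v : Fin b // Sum.inr v ∉ P}

/-- No set of at most half of the vertices, given by its parts `A` and `C` on the two sides, has
almost all of its vertices matched inside the set by each of the three matchings. -/
def AreMixing {b : ℕ} (N : ℕ) {P : Finset (GadgetVertex b)} (π₀ π₁ : Fin b ≃ Fin b)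
    (ρ : LeftNonports P ≃ RightNonports P) : Prop :=
  ∀ A C : Finset (Fin b), 0 < A.card + C.card → A.card + C.card ≤ b →
    2 * N * matchedCard π₀ A C + (A.card + C.card) ≤ N * (A.card + C.card) ∨
    2 * N * matchedCard π₁ A C + (A.card + C.card) ≤ N * (A.card + C.card) ∨
    2 * N * matchedCard ρ (A.subtype _) (C.subtype _) + (A.card + C.card)
      ≤ N * (A.card + C.card)

theorem isPortExpander_of_areMixing {b : ℕ} {G : SimpleGraph (GadgetVertex b)} {N : ℕ}
    (hN : 0 < N) {P : Finset (GadgetVertex b)} {π₀ π₁ : Fin b ≃ Fin b}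
    {ρ : LeftNonports P ≃ RightNonports P}
    (h₀ : ∀ u, G.Adj (Sum.inl u) (Sum.inr (π₀ u))) (h₁ : ∀ u, G.Adj (Sum.inl u) (Sum.inr (π₁ u)))
    (hρ : ∀ u, G.Adj (Sum.inl u.1) (Sum.inr (ρ u).1)) (hmix : AreMixing N π₀ π₁ ρ)
    (hsep : ∀ u ∈ P, ∀ u' ∈ P, ∀ k, 1 ≤ k → k ≤ 2 * (4 * N) →
      (alternatingStep π₀ π₁ ^ k) u ≠ u') :
    IsPortExpander G P (1 / (6 * N)) := by
  intro S hS
  rw [Fintype.card_sum, Fintype.card_fin] at hS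
  have hadj : ∀ x, G.Adj x (alternatingStep π₀ π₁ x) := by
    rintro (u | v)
    · exact h₀ u
    · simpa using (h₁ (π₁.symm v)).symm
  have hport := two_mul_card_inter_le G _ hadj P (4 * N) hsep S
  set A : Finset (Fin b) := Finset.univ.filter fun u => Sum.inl u ∈ S with hA
  set C : Finset (Fin b) := Finset.univ.filter fun v => Sum.inr v ∈ S with hC
  have hAC : A.card + C.card = S.card := by
    have h := Finset.card_toLeft_add_card_toRight (u := S)
    have e1 : S.toLeft = A := by ext; simp [hA]
    have e2 : S.toRight = C := by ext; simp [hC]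
    rwa [e1, e2] at h
  have hfull : ∀ π : Fin b ≃ Fin b, (∀ u, G.Adj (Sum.inl u) (Sum.inr (π u))) →
      S.card ≤ (cutPairs G S).card + 2 * matchedCard π A C := by
    intro π hπ
    have h := card_filter_add_card_filter_le_card_cutPairs G Sum.inl Sum.inr Sum.inl_injective
      (by simp) π hπ S
    rw [← hA, ← hC, hAC] at h
    simpa [matchedCard, hA, hC, Finset.filter_filter] using h
  have hpartial : S.card ≤ (cutPairs G S).card + (S ∩ P).card
      + 2 * matchedCard ρ (A.subtype _) (C.subtype _) := by
    have h := card_filter_add_card_filter_le_card_cutPairs G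
      (fun u : LeftNonports P => Sum.inl u.1) (fun v : RightNonports P => Sum.inr v.1)
      (fun u u' h => Subtype.ext (Sum.inl_injective h))
      (by simp) ρ hρ S
    have e1 : (Finset.univ.filter fun u : LeftNonports P => Sum.inl u.1 ∈ S).card
        + (Finset.univ.filter fun v : RightNonports P => Sum.inr v.1 ∈ S).card
        = (S \ P).card := by
      rw [← Finset.card_toLeft_add_card_toRight (u := S \ P)]
      congr 1
      · apply Finset.card_bij (fun u _ => u.1)
        · intro u hu; simpa [u.2] using hu
        · intro u _ u' _ h; exact Subtype.ext h
        · intro u hu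
          simp only [Finset.mem_toLeft, Finset.mem_sdiff] at hu
          exact ⟨⟨u, hu.2⟩, by simpa using hu.1, rfl⟩
      · apply Finset.card_bij (fun u _ => u.1)
        · intro u hu; simpa [u.2] using hu
        · intro u _ u' _ h; exact Subtype.ext h
        · intro u hu
          simp only [Finset.mem_toRight, Finset.mem_sdiff] at hu
          exact ⟨⟨u, hu.2⟩, by simpa using hu.1, rfl⟩
    have e2 : (Finset.univ.filter fun u : LeftNonports P =>
        Sum.inl u.1 ∈ S ∧ Sum.inr (ρ u).1 ∈ S).card
        = matchedCard ρ (A.subtype _) (C.subtype _) := by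
      unfold matchedCard
      congr 1
      ext u
      simp [hA, hC]
    have e3 := Finset.card_sdiff_add_card_inter S P
    rw [e1, e2] at h
    omega
  rcases Nat.eq_zero_or_pos S.card with h0 | h0
  · rw [Finset.card_eq_zero.1 h0]; simp
  have hkey : S.card ≤ N * ((cutPairs G S).card + (S ∩ P).card) := by
    have hm := hmix A C (by omega) (by omega)
    rw [hAC] at hm
    rcases hm with hm | hm | hm
    · have := Nat.mul_le_mul_left N (hfull π₀ h₀)
      nlinarith
    · have := Nat.mul_le_mul_left N (hfull π₁ h₁)
      nlinarith
    · have := Nat.mul_le_mul_left N hpartial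
      nlinarith
  have hNpos : (0 : ℝ) < N := by exact_mod_cast hN
  have hkey' : (S.card : ℝ) ≤ N * ((cutPairs G S).card + (S ∩ P).card) := by exact_mod_cast hkey
  have hport' : 2 * ((S ∩ P).card : ℝ) * (4 * N) ≤ 4 * N * (cutPairs G S).card + S.card := by
    exact_mod_cast hport
  rw [div_mul_eq_mul_div, one_mul, ← le_sub_iff_add_le', div_le_iff₀ (by positivity)]
  nlinarith

/-! ### Uniform matchings and fixed sets -/

open Classical in
/-- A uniform matching maps `A` onto `C` with probability at most the reciprocal of the number of
sets of that size, since all the possible images of `A` are equally likely. -/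
theorem card_image_eq_mul_choose_le {α β : Type} [Fintype α] [DecidableEq α] [Fintype β]
    [DecidableEq β] (A : Finset α) (C : Finset β) {t : ℕ} (hC : C.card = t) :
    (Finset.univ.filter fun e : α ≃ β => A.image e = C).card * (Fintype.card β).choose t
      ≤ Fintype.card (α ≃ β) := by
  have hg : ∀ C' : Finset β, ∃ g : Equiv.Perm β, C'.card = t → C.image g = C' := by
    intro C'
    by_cases h : C'.card = t
    · have e : {x // x ∈ C} ≃ {x // x ∈ C'} := Finset.equivOfCardEq (hC.trans h.symm)
      refine ⟨e.extendSubtype, fun _ => ?_⟩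
      apply Finset.eq_of_subset_of_card_le
      · intro y hy
        obtain ⟨x, hx, rfl⟩ := Finset.mem_image.1 hy
        exact e.extendSubtype_mem x hx
      · rw [Finset.card_image_of_injective _ (Equiv.injective _), h, hC]
    · exact ⟨1, fun h' => absurd h' h⟩
  choose g hg using hg
  rw [← Finset.card_univ (α := β), ← Finset.card_powersetCard, ← Finset.card_product,
    ← Finset.card_univ]
  apply Finset.card_le_card_of_injOn (fun z => z.1.trans (g z.2)) (fun _ _ => Finset.mem_coe.2
    (Finset.mem_univ _))
  rintro ⟨e, C'⟩ h ⟨e', C''⟩ h' heq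
  simp only [Finset.coe_product, Set.mem_prod, Finset.mem_coe, Finset.mem_filter,
    Finset.mem_univ, true_and, Finset.mem_powersetCard, Finset.subset_univ] at h h'
  have key : ∀ (e : α ≃ β) (C' : Finset β), A.image e = C → C'.card = t →
      A.image (e.trans (g C')) = C' := by
    intro e C' h1 h2
    calc A.image (e.trans (g C')) = (A.image e).image (g C') := by
          rw [Finset.image_image]; rfl
      _ = C' := by rw [h1, hg C' h2]
  have hCC : C' = C'' := by
    rw [← key e C' h.1 h.2, ← key e' C'' h'.1 h'.2]
    exact congrArg (fun f : α ≃ β => A.image f) heq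
  subst hCC
  simp only at heq
  have hee : e = e' := by
    ext x
    have := congrArg (fun f : α ≃ β => f x) heq
    simpa using this
  rw [hee]

open Classical in
theorem card_le_matchedCard_mul_choose_le {α β : Type} [Fintype α] [DecidableEq α] [Fintype β]
    [DecidableEq β] (A : Finset α) (C : Finset β) (t : ℕ) :
    (Finset.univ.filter fun e : α ≃ β => t ≤ matchedCard e A C).card * (Fintype.card β).choose t
      ≤ A.card.choose t * C.card.choose t * Fintype.card (α ≃ β) := by
  have hsub : (Finset.univ.filter fun e : α ≃ β => t ≤ matchedCard e A C) ⊆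
      (A.powersetCard t ×ˢ C.powersetCard t).biUnion fun z =>
        Finset.univ.filter fun e : α ≃ β => z.1.image e = z.2 := by
    intro e he
    simp only [Finset.mem_filter, Finset.mem_univ, true_and] at he
    obtain ⟨A', hA', hcard⟩ := Finset.exists_subset_card_eq he
    simp only [Finset.mem_biUnion, Finset.mem_product, Finset.mem_powersetCard,
      Finset.mem_filter, Finset.mem_univ, true_and]
    refine ⟨(A', A'.image e), ⟨⟨hA'.trans (Finset.filter_subset _ _), hcard⟩, ?_, ?_⟩, rfl⟩
    · intro y hy
      obtain ⟨x, hx, rfl⟩ := Finset.mem_image.1 hy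
      exact (Finset.mem_filter.1 (hA' hx)).2
    · rw [Finset.card_image_of_injective _ e.injective, hcard]
  calc _ ≤ (∑ z ∈ A.powersetCard t ×ˢ C.powersetCard t,
        (Finset.univ.filter fun e : α ≃ β => z.1.image e = z.2).card)
          * (Fintype.card β).choose t := by
        gcongr
        exact (Finset.card_le_card hsub).trans Finset.card_biUnion_le
    _ = ∑ z ∈ A.powersetCard t ×ˢ C.powersetCard t,
        (Finset.univ.filter fun e : α ≃ β => z.1.image e = z.2).card
          * (Fintype.card β).choose t := Finset.sum_mul _ _ _
    _ ≤ ∑ z ∈ A.powersetCard t ×ˢ C.powersetCard t, Fintype.card (α ≃ β) := by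
        apply Finset.sum_le_sum
        intro z hz
        simp only [Finset.mem_product, Finset.mem_powersetCard] at hz
        exact card_image_eq_mul_choose_le z.1 z.2 hz.2.2
    _ = _ := by
        rw [Finset.sum_const, Finset.card_product, Finset.card_powersetCard,
          Finset.card_powersetCard, smul_eq_mul]

/-! ### First hitting times on random alternating cycles -/

theorem alternatingStep_injective {α : Type} :
    Function.Injective fun π : (α ≃ α) × (α ≃ α) => alternatingStep π.1 π.2 := by
  rintro ⟨π₀, π₁⟩ ⟨π₀', π₁'⟩ h
  have h0 : π₀ = π₀' := by
    ext u
    have := congrArg (fun f : Equiv.Perm (α ⊕ α) => f (Sum.inl u)) h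
    simpa using this
  have h1 : π₁.symm = π₁'.symm := by
    ext u
    have := congrArg (fun f : Equiv.Perm (α ⊕ α) => f (Sum.inr u)) h
    simpa using this
  rw [h0, Equiv.symm_bijective.injective h1]

open Classical in
/-- Every vertex `u'` can be exchanged with each vertex `ι x` of its side in the images of the
alternating step, by changing one of the two matchings. -/
theorem exists_swap_alternatingStep {α : Type} [DecidableEq α] (u' : α ⊕ α) :
    ∃ (ι : α → α ⊕ α) (F : α → (α ≃ α) × (α ≃ α) → (α ≃ α) × (α ≃ α)), Function.Injective ι ∧
      ∀ x π, alternatingStep (F x π).1 (F x π).2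
        = Equiv.swap u' (ι x) * alternatingStep π.1 π.2 := by
  rcases u' with v | v
  · refine ⟨Sum.inl, fun x π => (π.1, (Equiv.swap v x).trans π.2), Sum.inl_injective, ?_⟩
    intro x π
    ext (u | w)
    · simp [Equiv.swap_apply_of_ne_of_ne]
    · simp [Sum.inl_injective.map_swap]
  · refine ⟨Sum.inr, fun x π => (π.1.trans (Equiv.swap v x), π.2), Sum.inr_injective, ?_⟩
    intro x π
    ext (u | w)
    · simp [Sum.inr_injective.map_swap]
    · simp [Equiv.swap_apply_of_ne_of_ne]

open Classical in
/-- The walk from `u` along random alternating cycles first hits `u'` at time `k` with probability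
at most about `1 / |α|`: redirecting its last step to any vertex not visited before gives distinct
pairs of matchings. -/
theorem card_first_hit_mul_le {α : Type} [Fintype α] [DecidableEq α] (u u' : α ⊕ α)
    (k : ℕ) (hk : 1 ≤ k) :
    (Finset.univ.filter fun π : (α ≃ α) × (α ≃ α) => (alternatingStep π.1 π.2 ^ k) u = u' ∧
      ∀ i, 1 ≤ i → i < k → (alternatingStep π.1 π.2 ^ i) u ≠ u').card * (Fintype.card α - k)
      ≤ Fintype.card ((α ≃ α) × (α ≃ α)) := by
  obtain ⟨ι, F, hι, hF⟩ := exists_swap_alternatingStep u'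
  set hit := Finset.univ.filter fun π : (α ≃ α) × (α ≃ α) =>
    (alternatingStep π.1 π.2 ^ k) u = u' ∧
      ∀ i, 1 ≤ i → i < k → (alternatingStep π.1 π.2 ^ i) u ≠ u' with hhit
  set free : (α ≃ α) × (α ≃ α) → Finset α := fun π =>
    Finset.univ.filter fun x => ∀ i ∈ Finset.Ico 1 k, (alternatingStep π.1 π.2 ^ i) u ≠ ι x
    with hfree
  have hfreecard : ∀ π, Fintype.card α - k ≤ (free π).card := by
    intro π
    have h1 := Finset.card_filter_add_card_filter_not (s := (Finset.univ : Finset α))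
      (fun x => ∀ i ∈ Finset.Ico 1 k, (alternatingStep π.1 π.2 ^ i) u ≠ ι x)
    have h2 : (Finset.univ.filter fun x =>
        ¬ ∀ i ∈ Finset.Ico 1 k, (alternatingStep π.1 π.2 ^ i) u ≠ ι x).card
        ≤ (Finset.Ico 1 k).card := by
      calc _ ≤ ((Finset.univ.filter fun x =>
            ¬ ∀ i ∈ Finset.Ico 1 k, (alternatingStep π.1 π.2 ^ i) u ≠ ι x).image ι).card := by
              rw [Finset.card_image_of_injective _ hι]
        _ ≤ ((Finset.Ico 1 k).image fun i => (alternatingStep π.1 π.2 ^ i) u).card := by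
              apply Finset.card_le_card
              intro y hy
              simp only [Finset.mem_image, Finset.mem_filter, Finset.mem_univ, true_and] at hy
              obtain ⟨x, hx, rfl⟩ := hy
              push Not at hx
              obtain ⟨i, hi, h⟩ := hx
              exact Finset.mem_image.2 ⟨i, hi, h⟩
        _ ≤ _ := Finset.card_image_le
    rw [Nat.card_Ico] at h2
    rw [Finset.card_univ] at h1
    simp only [hfree]
    omega
  have hwalk : ∀ π ∈ hit, ∀ x ∈ free π,
      (alternatingStep (F x π).1 (F x π).2 ^ k) u = ι x := by
    intro π hπ x hx
    simp only [hhit, Finset.mem_filter, Finset.mem_univ, true_and] at hπ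
    simp only [hfree, Finset.mem_filter, Finset.mem_univ, true_and, Finset.mem_Ico] at hx
    have hi : ∀ i < k, (alternatingStep (F x π).1 (F x π).2 ^ i) u
        = (alternatingStep π.1 π.2 ^ i) u := by
      intro i
      induction i with
      | zero => simp
      | succ i ih =>
        intro hi
        rw [pow_succ', Equiv.Perm.mul_apply, ih (by omega), hF, Equiv.Perm.mul_apply,
          ← Equiv.Perm.mul_apply (alternatingStep π.1 π.2), ← pow_succ']
        exact Equiv.swap_apply_of_ne_of_ne (hπ.2 _ (by omega) hi) (hx _ ⟨by omega, hi⟩)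
    obtain ⟨j, rfl⟩ : ∃ j, k = j + 1 := ⟨k - 1, by omega⟩
    rw [pow_succ', Equiv.Perm.mul_apply, hi j (by omega), hF, Equiv.Perm.mul_apply,
      ← Equiv.Perm.mul_apply (alternatingStep π.1 π.2), ← pow_succ', hπ.1, Equiv.swap_apply_left]
  calc hit.card * (Fintype.card α - k) = ∑ π ∈ hit, (Fintype.card α - k) := by
        rw [Finset.sum_const, smul_eq_mul]
    _ ≤ ∑ π ∈ hit, (free π).card := Finset.sum_le_sum fun π _ => hfreecard π
    _ = (hit.sigma free).card := (Finset.card_sigma _ _).symm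
    _ ≤ (Finset.univ : Finset ((α ≃ α) × (α ≃ α))).card := by
        apply Finset.card_le_card_of_injOn (fun z => F z.2 z.1)
          (fun _ _ => Finset.mem_coe.2 (Finset.mem_univ _))
        rintro ⟨π, x⟩ h ⟨π', x'⟩ h' heq
        simp only [Finset.mem_coe, Finset.mem_sigma] at h h' heq
        have h1 := hwalk π h.1 x h.2
        rw [heq, hwalk π' h'.1 x' h'.2] at h1
        obtain rfl := hι h1
        have h2 := hF x' π
        rw [heq, hF] at h2
        rw [alternatingStep_injective (mul_left_cancel h2)]
    _ = _ := Finset.card_univ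

open Classical in
theorem card_hit_mul_le {α : Type} [Fintype α] [DecidableEq α] (u u' : α ⊕ α) (m : ℕ) :
    (Finset.univ.filter fun π : (α ≃ α) × (α ≃ α) =>
      ∃ k, 1 ≤ k ∧ k ≤ m ∧ (alternatingStep π.1 π.2 ^ k) u = u').card * (Fintype.card α - m)
      ≤ m * Fintype.card ((α ≃ α) × (α ≃ α)) := by
  have hsub : (Finset.univ.filter fun π : (α ≃ α) × (α ≃ α) =>
      ∃ k, 1 ≤ k ∧ k ≤ m ∧ (alternatingStep π.1 π.2 ^ k) u = u') ⊆
      (Finset.Icc 1 m).biUnion fun k => Finset.univ.filter fun π : (α ≃ α) × (α ≃ α) =>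
        (alternatingStep π.1 π.2 ^ k) u = u' ∧
          ∀ i, 1 ≤ i → i < k → (alternatingStep π.1 π.2 ^ i) u ≠ u' := by
    intro π hπ
    simp only [Finset.mem_filter, Finset.mem_univ, true_and] at hπ
    have hspec := Nat.find_spec hπ
    have hmin := fun j => Nat.find_min (m := j) hπ
    simp only [Finset.mem_biUnion, Finset.mem_filter, Finset.mem_univ, true_and, Finset.mem_Icc]
    exact ⟨Nat.find hπ, ⟨hspec.1, hspec.2.1⟩, hspec.2.2,
      fun i h1 h2 h3 => hmin i h2 ⟨h1, h2.le.trans hspec.2.1, h3⟩⟩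
  calc _ ≤ (∑ k ∈ Finset.Icc 1 m, (Finset.univ.filter fun π : (α ≃ α) × (α ≃ α) =>
        (alternatingStep π.1 π.2 ^ k) u = u' ∧
          ∀ i, 1 ≤ i → i < k → (alternatingStep π.1 π.2 ^ i) u ≠ u').card)
          * (Fintype.card α - m) := by
        gcongr
        exact (Finset.card_le_card hsub).trans Finset.card_biUnion_le
    _ ≤ ∑ k ∈ Finset.Icc 1 m, Fintype.card ((α ≃ α) × (α ≃ α)) := by
        rw [Finset.sum_mul]
        apply Finset.sum_le_sum
        intro k hk
        rw [Finset.mem_Icc] at hk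
        exact (Nat.mul_le_mul_left _ (by omega)).trans (card_first_hit_mul_le u u' k hk.1)
    _ = _ := by simp

/-! ### Binomial estimates -/

theorem pow_self_le_pow_self_mul_choose (t : ℕ) : ∀ n, t ≤ n → n ^ t ≤ t ^ t * n.choose t := by
  induction t with
  | zero => simp
  | succ t ih =>
    intro n hn
    obtain ⟨n, rfl⟩ : ∃ m, n = m + 1 := ⟨n - 1, by omega⟩
    have hn' : t ≤ n := by omega
    have h1 : (n + 1) ^ t ≤ (t + 1) ^ t * n.choose t := by
      rcases Nat.eq_zero_or_pos t with rfl | ht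
      · simp
      · have h2 : (n + 1) * t ≤ (t + 1) * n := by nlinarith
        have h3 := Nat.pow_le_pow_left h2 t
        rw [mul_pow, mul_pow] at h3
        have h4 := Nat.mul_le_mul_left ((t + 1) ^ t) (ih n hn')
        have h5 : 0 < t ^ t := by positivity
        refine Nat.le_of_mul_le_mul_right ?_ h5
        nlinarith
    calc (n + 1) ^ (t + 1) = (n + 1) ^ t * (n + 1) := pow_succ _ _
      _ ≤ (t + 1) ^ t * n.choose t * (n + 1) := Nat.mul_le_mul_right _ h1
      _ = (t + 1) ^ t * ((n + 1) * n.choose t) := by ring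
      _ = (t + 1) ^ t * ((n + 1).choose (t + 1) * (t + 1)) := by rw [Nat.add_one_mul_choose_eq]
      _ = _ := by ring

theorem choose_mul_pow_le_exp (m r : ℕ) {z : ℝ} (hz : 0 ≤ z) :
    (m.choose r : ℝ) * z ^ r ≤ Real.exp (z * m) := by
  have h1 : (m.choose r : ℝ) * z ^ r ≤ (z + 1) ^ m := by
    rcases le_or_gt r m with h | h
    · rw [add_pow]
      refine le_trans (le_of_eq ?_) (Finset.single_le_sum
        (f := fun k => z ^ k * 1 ^ (m - k) * (m.choose k : ℝ)) (fun k _ => by positivity)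
        (Finset.mem_range.2 (Nat.lt_succ_of_le h)))
      simp [mul_comm]
    · rw [Nat.choose_eq_zero_of_lt h]
      simp only [Nat.cast_zero, zero_mul]
      positivity
  refine h1.trans ?_
  rw [mul_comm, Real.exp_nat_mul]
  exact pow_le_pow_left₀ (by linarith) (Real.add_one_le_exp z) m

theorem choose_mul_choose_le (m n i j : ℕ) :
    m.choose i * n.choose j ≤ (m + n).choose (i + j) := by
  rw [Nat.add_choose_eq]
  exact Finset.single_le_sum (f := fun ij : ℕ × ℕ => m.choose ij.1 * n.choose ij.2)
    (fun _ _ => Nat.zero_le _) (a := (i, j)) (by simp)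

/-- The entropy estimate behind the union bound over vertex sets of size `s`. With `r = s - 2t` at
most `s / 1200`, the left side is at most `(s / 2b)⁻ʳ` up to a factor `exp (O(s / 80))`, while the
third matching contributes `n.choose t`, which is at least `(s / 2b)⁻ᵗ` up to such a factor, and
`t` is nearly `s / 2`. -/
theorem choose_mul_choose_sq_le {b n s t : ℕ} (hs : 1 ≤ s) (hsb : s ≤ b) (hn : 79 * b ≤ 80 * n)
    (hts : 2 * t ≤ s) (ht : 1200 * s < s + 2 * 1200 * t) :
    ((2 * b).choose (s - 2 * t) : ℝ) * (s.choose (2 * t) : ℝ) ^ 2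
      ≤ s / b * Real.exp (-(s / 16)) * n.choose t := by
  obtain ⟨r, hr⟩ : ∃ r, s = r + 2 * t := ⟨s - 2 * t, by omega⟩
  have hsub : s - 2 * t = r := by omega
  have hr1200 : 1200 * r < s := by omega
  obtain ⟨m, hm⟩ : ∃ m, t = r + 1 + m := ⟨t - r - 1, by omega⟩
  have hsym : s.choose (2 * t) = s.choose r := by
    rw [Nat.choose_symm_of_eq_add hr]
  rw [hsub, hsym]
  have hb0 : (0 : ℝ) < b := by exact_mod_cast hs.trans hsb
  have hs0 : (0 : ℝ) < s := by exact_mod_cast hs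
  have hn0 : (0 : ℝ) < n := by
    have : (79 : ℝ) * b ≤ 80 * n := by exact_mod_cast hn
    linarith
  set u : ℝ := s / (2 * b) with hu
  have hu0 : 0 < u := by positivity
  have hu2 : u ≤ 1 / 2 := by
    rw [hu, div_le_iff₀ (by positivity)]
    have : (s : ℝ) ≤ b := by exact_mod_cast hsb
    linarith
  have h1 : ((2 * b).choose r : ℝ) * (u / 80) ^ r ≤ Real.exp (s / 80) := by
    have h := choose_mul_pow_le_exp (2 * b) r (z := u / 80) (by positivity)
    have e : u / 80 * ((2 * b : ℕ) : ℝ) = s / 80 := by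
      rw [hu]; push_cast; field_simp
    rwa [e] at h
  have h2 : (s.choose r : ℝ) * (1 / 80) ^ r ≤ Real.exp (s / 80) := by
    have h := choose_mul_pow_le_exp s r (z := 1 / 80) (by norm_num)
    rwa [one_div_mul_eq_div] at h
  have h3 : 1 ≤ u ^ t * Real.exp (s / 80) * (n.choose t : ℝ) := by
    have htn : t ≤ n := by omega
    have h := pow_self_le_pow_self_mul_choose t n htn
    have h' : (n : ℝ) ^ t ≤ (t : ℝ) ^ t * n.choose t := by exact_mod_cast h
    have htu : (t : ℝ) ≤ u * Real.exp (1 / 79) * n := by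
      have e1 : (80 / 79 : ℝ) ≤ Real.exp (1 / 79) :=
        le_trans (by norm_num) (Real.add_one_le_exp _)
      have e2 : (79 : ℝ) * b ≤ 80 * n := by exact_mod_cast hn
      have e3 : (2 : ℝ) * t ≤ s := by exact_mod_cast hts
      calc (t : ℝ) ≤ u * b := by rw [hu]; field_simp; linarith
        _ ≤ u * (80 / 79 * n) := by gcongr; linarith
        _ ≤ u * (Real.exp (1 / 79) * n) := by gcongr
        _ = _ := by ring
    have h4 : (n : ℝ) ^ t * 1 ≤ n ^ t * (u ^ t * Real.exp (s / 80) * (n.choose t : ℝ)) := by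
      calc (n : ℝ) ^ t * 1 ≤ (t : ℝ) ^ t * n.choose t := by rw [mul_one]; exact h'
        _ ≤ (u * Real.exp (1 / 79) * n) ^ t * n.choose t := by gcongr
        _ = n ^ t * (u ^ t * Real.exp (t * (1 / 79)) * n.choose t) := by
            rw [mul_pow, mul_pow, ← Real.exp_nat_mul]; ring
        _ ≤ _ := by
            gcongr
            have e3 : (2 : ℝ) * t ≤ s := by exact_mod_cast hts
            linarith
    exact le_of_mul_le_mul_left h4 (by positivity)
  have h80 : (80 : ℝ) ^ (3 * r) ≤ Real.exp (s / 80) := by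
    have e1 : (80 : ℝ) ≤ Real.exp 5 := by
      have := Real.exp_one_gt_d9
      calc (80 : ℝ) ≤ (2.7 : ℝ) ^ 5 := by norm_num
        _ ≤ Real.exp 1 ^ 5 := by gcongr; linarith
        _ = Real.exp 5 := by rw [← Real.exp_nat_mul]; norm_num
    calc (80 : ℝ) ^ (3 * r) ≤ Real.exp 5 ^ (3 * r) := by gcongr
      _ = Real.exp (15 * r) := by rw [← Real.exp_nat_mul]; push_cast; ring_nf
      _ ≤ _ := by
        apply Real.exp_le_exp.mpr
        have : (1200 : ℝ) * r ≤ s := by exact_mod_cast hr1200.le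
        linarith
  have hum : u ^ m ≤ 2 * Real.exp (-(s / 8)) := by
    have e1 : (1 / 2 : ℝ) ≤ Real.exp (-(1 / 2)) :=
      le_trans (by norm_num) (Real.add_one_le_exp _)
    calc u ^ m ≤ (1 / 2) ^ m := by gcongr
      _ = 2 * (1 / 2) ^ (m + 1) := by rw [pow_succ]; ring
      _ ≤ 2 * Real.exp (-(1 / 2)) ^ (m + 1) := by gcongr
      _ = 2 * Real.exp (((m + 1 : ℕ) : ℝ) * -(1 / 2)) := by rw [← Real.exp_nat_mul]
      _ ≤ _ := by
        gcongr
        have : (s : ℝ) ≤ 4 * ((m + 1 : ℕ) : ℝ) := by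
          have : s ≤ 4 * (m + 1) := by omega
          exact_mod_cast this
        linarith
  have hprod : ((2 * b).choose r : ℝ) * (s.choose r : ℝ) ^ 2 * u ^ r
      ≤ Real.exp (s / 80) ^ 3 * 80 ^ (3 * r) := by
    calc _ = (((2 * b).choose r : ℝ) * (u / 80) ^ r) * ((s.choose r : ℝ) * (1 / 80) ^ r) ^ 2
          * 80 ^ (3 * r) := by
          have e : (80 : ℝ) ^ (3 * r) = 80 ^ r * 80 ^ r * 80 ^ r := by ring
          rw [e, div_pow u, div_pow (1 : ℝ), one_pow]
          field_simp
      _ ≤ Real.exp (s / 80) * Real.exp (s / 80) ^ 2 * 80 ^ (3 * r) := by gcongr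
      _ = _ := by ring
  refine le_of_mul_le_mul_right ?_ (pow_pos hu0 r)
  calc _ ≤ Real.exp (s / 80) ^ 3 * 80 ^ (3 * r) := hprod
    _ ≤ Real.exp (s / 80) ^ 3 * Real.exp (s / 80)
        * (u ^ t * Real.exp (s / 80) * (n.choose t : ℝ)) := by
        refine le_trans ?_ (le_mul_of_one_le_right (by positivity) h3)
        gcongr
    _ = u * (u ^ m * Real.exp (s / 80) ^ 5) * n.choose t * u ^ r := by
        rw [hm, pow_add, pow_add]; ring
    _ ≤ u * (2 * Real.exp (-(s / 8)) * Real.exp (s / 80) ^ 5) * n.choose t * u ^ r := by gcongr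
    _ = s / b * Real.exp (-(s / 16)) * n.choose t * u ^ r := by
        have e : Real.exp (-(s / 8)) * Real.exp (s / 80) ^ 5 = Real.exp (-((s : ℝ) / 16)) := by
          rw [← Real.exp_nat_mul, ← Real.exp_add]
          congr 1; push_cast; ring
        rw [mul_assoc 2, e, hu]
        field_simp

theorem exists_sum_sq_mul_exp_le : ∃ C : ℝ, 0 ≤ C ∧ ∀ b : ℕ,
    ∑ s ∈ Finset.Icc 1 b, ((s : ℝ) + 1) * (s * Real.exp (-(s / 16))) ≤ C := by
  have h1 : ‖Real.exp (-(1 / 16))‖ < 1 := by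
    rw [Real.norm_eq_abs, Real.abs_exp, Real.exp_lt_one_iff]
    norm_num
  have h2 := summable_pow_mul_geometric_of_norm_lt_one 2 h1
  have h3 := summable_pow_mul_geometric_of_norm_lt_one 1 h1
  have h4 : Summable fun s : ℕ => ((s : ℝ) + 1) * (s * Real.exp (-(s / 16))) := by
    refine (h2.add h3).congr fun s => ?_
    rw [← Real.exp_nat_mul]
    ring_nf
  exact ⟨_, tsum_nonneg fun s => by positivity,
    fun b => h4.sum_le_tsum _ fun s _ => by positivity⟩

/-! ### Triples of random matchings -/

theorem matchedCard_le_left {α β : Type} [DecidableEq β] (e : α ≃ β) (A : Finset α) (C : Finset β) :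
    matchedCard e A C ≤ A.card :=
  Finset.card_filter_le _ _

theorem matchedCard_le_right {α β : Type} [DecidableEq β] (e : α ≃ β) (A : Finset α)
    (C : Finset β) :
    matchedCard e A C ≤ C.card :=
  Finset.card_le_card_of_injOn e (fun _ hx => (Finset.mem_filter.1 (Finset.mem_coe.1 hx)).2)
    e.injective.injOn

theorem Finset.card_subtype_le {α : Type} (p : α → Prop) [DecidablePred p] (s : Finset α) :
    (s.subtype p).card ≤ s.card := by
  rw [Finset.card_subtype]
  exact Finset.card_filter_le _ _

/-- The matchings that matter for the expansion of a gadget with the set `P` of ports: two between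
the full sides, and one between the non-ports. -/
abbrev MatchingTriple {b : ℕ} (P : Finset (GadgetVertex b)) : Type :=
  ((Fin b ≃ Fin b) × (Fin b ≃ Fin b)) × (LeftNonports P ≃ RightNonports P)

/-- The triples of matchings that all have at least `t` edges between `A` and `C`. -/
def matchedTriples {b : ℕ} (P : Finset (GadgetVertex b)) (t : ℕ)
    (A C : Finset (Fin b)) : Finset (MatchingTriple P) :=
  ((Finset.univ.filter fun π : Fin b ≃ Fin b => t ≤ matchedCard π A C) ×ˢ
    (Finset.univ.filter fun π : Fin b ≃ Fin b => t ≤ matchedCard π A C)) ×ˢ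
    (Finset.univ.filter fun ρ : LeftNonports P ≃ RightNonports P =>
      t ≤ matchedCard ρ (A.subtype _) (C.subtype _))

/-- The probability that a given pair of sets is almost perfectly matched by all three matchings,
weighted by the number of pairs of these sizes. One of the three factors `1 / b.choose t`
compensates the choice of `A`, another one that of `C`. -/
theorem choose_mul_card_matchedTriples_le {b : ℕ} {P : Finset (GadgetVertex b)}
    (hP : 79 * b ≤ 80 * Fintype.card (RightNonports P)) {t : ℕ} {A C : Finset (Fin b)}
    (hs : 1 ≤ A.card + C.card) (hsb : A.card + C.card ≤ b)
    (ht : 1200 * (A.card + C.card) < (A.card + C.card) + 2 * 1200 * t) :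
    ((b.choose A.card * b.choose C.card : ℕ) : ℝ) * (matchedTriples P t A C).card
      ≤ ((A.card + C.card : ℕ) : ℝ) / b * Real.exp (-(((A.card + C.card : ℕ) : ℝ) / 16))
        * Fintype.card (MatchingTriple P) := by
  by_cases htAC : t ≤ A.card ∧ t ≤ C.card
  · obtain ⟨htA, htC⟩ := htAC
    set a := A.card with ha
    set c := C.card with hc
    set n := Fintype.card (RightNonports P) with hn
    have hX := card_le_matchedCard_mul_choose_le A C t
    rw [Fintype.card_fin, ← ha, ← hc] at hX
    have hY : (Finset.univ.filter fun ρ : LeftNonports P ≃ RightNonports P =>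
        t ≤ matchedCard ρ (A.subtype _) (C.subtype _)).card * n.choose t
        ≤ a.choose t * c.choose t * Fintype.card (LeftNonports P ≃ RightNonports P) := by
      refine (card_le_matchedCard_mul_choose_le _ _ t).trans ?_
      gcongr
      · exact Finset.card_subtype_le _ _
      · exact Finset.card_subtype_le _ _
    have hcard : (matchedTriples P t A C).card =
        (Finset.univ.filter fun π : Fin b ≃ Fin b => t ≤ matchedCard π A C).card *
        (Finset.univ.filter fun π : Fin b ≃ Fin b => t ≤ matchedCard π A C).card *
        (Finset.univ.filter fun ρ : LeftNonports P ≃ RightNonports P =>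
          t ≤ matchedCard ρ (A.subtype _) (C.subtype _)).card := by
      rw [matchedTriples, Finset.card_product, Finset.card_product]
    set x := (Finset.univ.filter fun π : Fin b ≃ Fin b => t ≤ matchedCard π A C).card
    set y := (Finset.univ.filter fun ρ : LeftNonports P ≃ RightNonports P =>
      t ≤ matchedCard ρ (A.subtype _) (C.subtype _)).card
    set X := Fintype.card (Fin b ≃ Fin b) with hXdef
    set Y := Fintype.card (LeftNonports P ≃ RightNonports P) with hYdef
    have hT : Fintype.card (MatchingTriple P) = X * X * Y := by
      rw [Fintype.card_prod, Fintype.card_prod]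
    have hb : 0 < b.choose t := Nat.choose_pos (by omega)
    have hnt : 0 < n.choose t := Nat.choose_pos (by omega)
    have hF : a.choose t * c.choose t ≤ (a + c).choose (2 * t) := by
      rw [two_mul]; exact choose_mul_choose_le a c t t
    have hG : (b - t).choose (a - t) * (b - t).choose (c - t)
        ≤ (2 * b).choose (a + c - 2 * t) := by
      refine (choose_mul_choose_le _ _ _ _).trans ?_
      have e : a - t + (c - t) = a + c - 2 * t := by omega
      rw [e]
      exact Nat.choose_le_choose _ (by omega)
    have ea : b.choose a * a.choose t = b.choose t * (b - t).choose (a - t) := Nat.choose_mul htA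
    have ec : b.choose c * c.choose t = b.choose t * (b - t).choose (c - t) := Nat.choose_mul htC
    have hnat : b.choose a * b.choose c * (x * x * y) * n.choose t
        ≤ (2 * b).choose (a + c - 2 * t) * (a + c).choose (2 * t) ^ 2 * (X * X * Y) := by
      refine Nat.le_of_mul_le_mul_right ?_ (pow_pos hb 2)
      calc b.choose a * b.choose c * (x * x * y) * n.choose t * b.choose t ^ 2
          = b.choose a * b.choose c * ((x * b.choose t) * (x * b.choose t)
            * (y * n.choose t)) := by ring
        _ ≤ b.choose a * b.choose c * ((a.choose t * c.choose t * X)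
            * (a.choose t * c.choose t * X) * (a.choose t * c.choose t * Y)) := by gcongr
        _ = (b.choose a * a.choose t) * (b.choose c * c.choose t)
            * (a.choose t * c.choose t) ^ 2 * (X * X * Y) := by ring
        _ = ((b - t).choose (a - t) * (b - t).choose (c - t))
            * (a.choose t * c.choose t) ^ 2 * (X * X * Y) * b.choose t ^ 2 := by
            rw [ea, ec]; ring
        _ ≤ (2 * b).choose (a + c - 2 * t) * (a + c).choose (2 * t) ^ 2 * (X * X * Y)
            * b.choose t ^ 2 := by gcongr
    have hnum := choose_mul_choose_sq_le hs hsb hP (by omega : 2 * t ≤ a + c) ht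
    have hnt' : (0 : ℝ) < n.choose t := by exact_mod_cast hnt
    rw [hcard, hT]
    refine le_of_mul_le_mul_right ?_ hnt'
    calc ((b.choose a * b.choose c : ℕ) : ℝ) * ((x * x * y : ℕ) : ℝ) * n.choose t
        ≤ ((2 * b).choose (a + c - 2 * t) : ℝ) * ((a + c).choose (2 * t) : ℝ) ^ 2
          * ((X * X * Y : ℕ) : ℝ) := by exact_mod_cast hnat
      _ ≤ (((a + c : ℕ) : ℝ) / b * Real.exp (-(((a + c : ℕ) : ℝ) / 16)) * n.choose t)
          * ((X * X * Y : ℕ) : ℝ) := by gcongr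
      _ = _ := by ring
  · have hempty : matchedTriples P t A C = ∅ := by
      apply Finset.eq_empty_of_forall_notMem
      intro z hz
      simp only [matchedTriples, Finset.mem_product, Finset.mem_filter] at hz
      exact htAC ⟨hz.1.1.2.trans (matchedCard_le_left _ _ _),
        hz.1.1.2.trans (matchedCard_le_right _ _ _)⟩
    rw [hempty]
    simp only [Finset.card_empty, Nat.cast_zero, mul_zero]
    positivity

open Classical in
/-- Mixing fails with probability `O(1 / b)`, uniformly in the set of ports: a union bound over all
pairs of sets, grouped by their sizes. -/
theorem exists_card_not_areMixing_le : ∃ K : ℝ, 0 ≤ K ∧ ∀ (b : ℕ) (P : Finset (GadgetVertex b)),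
    79 * b ≤ 80 * Fintype.card (RightNonports P) →
      ((Finset.univ.filter fun z : MatchingTriple P =>
        ¬ AreMixing 1200 z.1.1 z.1.2 z.2).card : ℝ)
        ≤ K / b * Fintype.card (MatchingTriple P) := by
  obtain ⟨K, hK0, hK⟩ := exists_sum_sq_mul_exp_le
  refine ⟨K, hK0, fun b P hP => ?_⟩
  set T : ℝ := ((Fintype.card (MatchingTriple P) : ℕ) : ℝ) with hT
  -- the least `t` with `1200 * s < s + 2400 * t`
  set t : ℕ → ℕ := fun s => 1199 * s / 2400 + 1 with ht
  have hsub : (Finset.univ.filter fun z : MatchingTriple P =>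
      ¬ AreMixing 1200 z.1.1 z.1.2 z.2) ⊆
      (Finset.Icc 1 b).biUnion fun s => (Finset.HasAntidiagonal.antidiagonal s).biUnion fun ac =>
        ((Finset.univ.powersetCard ac.1) ×ˢ (Finset.univ.powersetCard ac.2)).biUnion fun AC =>
          matchedTriples P (t s) AC.1 AC.2 := by
    intro z hz
    have hz := (Finset.mem_filter.1 hz).2
    unfold AreMixing at hz
    push Not at hz
    obtain ⟨A, C, h0, hb, h1, h2, h3⟩ := hz
    simp only [Finset.mem_biUnion, Finset.mem_Icc, Finset.mem_product, Finset.mem_powersetCard,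
      Finset.subset_univ, true_and, Finset.HasAntidiagonal.mem_antidiagonal]
    refine ⟨A.card + C.card, ⟨h0, hb⟩, (A.card, C.card), rfl, (A, C), ⟨rfl, rfl⟩, ?_⟩
    simp only [matchedTriples, Finset.mem_product, Finset.mem_filter, Finset.mem_univ, true_and, ht]
    refine ⟨⟨?_, ?_⟩, ?_⟩ <;> omega
  have hpair : ∀ s ∈ Finset.Icc 1 b, ∀ ac ∈ Finset.HasAntidiagonal.antidiagonal s,
      ∑ AC ∈ (Finset.univ.powersetCard ac.1) ×ˢ (Finset.univ.powersetCard ac.2),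
        ((matchedTriples P (t s) AC.1 AC.2).card : ℝ) ≤ s / b * Real.exp (-(s / 16)) * T := by
    rintro s hs ⟨a, c⟩ hac
    rw [Finset.mem_Icc] at hs
    simp only [Finset.HasAntidiagonal.mem_antidiagonal] at hac
    subst hac
    have hpos : (0 : ℝ) < ((b.choose a * b.choose c : ℕ) : ℝ) := by
      exact_mod_cast Nat.mul_pos (Nat.choose_pos (by omega)) (Nat.choose_pos (by omega))
    have hle : ∀ AC ∈ (Finset.univ.powersetCard a : Finset (Finset (Fin b))) ×ˢ
        (Finset.univ.powersetCard c : Finset (Finset (Fin b))),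
        ((matchedTriples P (t (a + c)) AC.1 AC.2).card : ℝ) ≤
          ((a + c : ℕ) : ℝ) / b * Real.exp (-(((a + c : ℕ) : ℝ) / 16)) * T
            / ((b.choose a * b.choose c : ℕ) : ℝ) := by
      rintro ⟨A, C⟩ hAC
      simp only [Finset.mem_product, Finset.mem_powersetCard, Finset.subset_univ,
        true_and] at hAC
      obtain ⟨rfl, rfl⟩ := hAC
      rw [le_div_iff₀ hpos, mul_comm]
      exact choose_mul_card_matchedTriples_le hP hs.1 hs.2 (by simp only [ht]; omega)
    refine (Finset.sum_le_card_nsmul _ _ _ hle).trans (le_of_eq ?_)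
    rw [Finset.card_product, Finset.card_powersetCard, Finset.card_powersetCard, Finset.card_univ,
      Fintype.card_fin, nsmul_eq_mul, mul_div_cancel₀ _ hpos.ne']
  calc _ ≤ ∑ s ∈ Finset.Icc 1 b, ∑ ac ∈ Finset.HasAntidiagonal.antidiagonal s,
        ∑ AC ∈ (Finset.univ.powersetCard ac.1) ×ˢ (Finset.univ.powersetCard ac.2),
          ((matchedTriples P (t s) AC.1 AC.2).card : ℝ) := by
        have h := (Finset.card_le_card hsub).trans (Finset.card_biUnion_le.trans
          (Finset.sum_le_sum fun s _ => Finset.card_biUnion_le.trans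
            (Finset.sum_le_sum fun ac _ => Finset.card_biUnion_le)))
        exact_mod_cast h
    _ ≤ ∑ s ∈ Finset.Icc 1 b, ∑ ac ∈ Finset.HasAntidiagonal.antidiagonal s,
          (s / b * Real.exp (-(s / 16)) * T) :=
        Finset.sum_le_sum fun s hs => Finset.sum_le_sum fun ac hac => hpair s hs ac hac
    _ = (∑ s ∈ Finset.Icc 1 b, ((s : ℝ) + 1) * (s * Real.exp (-(s / 16)))) / b * T := by
        rw [Finset.sum_div, Finset.sum_mul]
        apply Finset.sum_congr rfl
        intro s _
        rw [Finset.sum_const, Finset.Nat.card_antidiagonal, nsmul_eq_mul]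
        push_cast
        ring
    _ ≤ _ := by
        gcongr
        exact hK b

/-- No port is reached from a port within `m` steps along the alternating cycles of the two full
matchings; in particular no port lies on such a cycle of length at most `m`. -/
def ArePortsSeparated {b : ℕ} (m : ℕ) (P : Finset (GadgetVertex b)) (π₀ π₁ : Fin b ≃ Fin b) :
    Prop :=
  ∀ u ∈ P, ∀ u' ∈ P, ∀ k, 1 ≤ k → k ≤ m → (alternatingStep π₀ π₁ ^ k) u ≠ u'

open Classical in
theorem card_not_arePortsSeparated_mul_le {b : ℕ} (m : ℕ) (P : Finset (GadgetVertex b)) :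
    (Finset.univ.filter fun z : MatchingTriple P =>
      ¬ ArePortsSeparated m P z.1.1 z.1.2).card * (b - m)
      ≤ P.card ^ 2 * m * Fintype.card (MatchingTriple P) := by
  set Y := Fintype.card (LeftNonports P ≃ RightNonports P) with hY
  have hsub : (Finset.univ.filter fun z : MatchingTriple P =>
      ¬ ArePortsSeparated m P z.1.1 z.1.2) ⊆ (P ×ˢ P).biUnion fun uu =>
        (Finset.univ.filter fun π : (Fin b ≃ Fin b) × (Fin b ≃ Fin b) =>
          ∃ k, 1 ≤ k ∧ k ≤ m ∧ (alternatingStep π.1 π.2 ^ k) uu.1 = uu.2) ×ˢ Finset.univ := by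
    intro z hz
    have hz := (Finset.mem_filter.1 hz).2
    unfold ArePortsSeparated at hz
    push Not at hz
    obtain ⟨u, hu, u', hu', k, h1, h2, h3⟩ := hz
    simp only [Finset.mem_biUnion, Finset.mem_product, Finset.mem_filter, Finset.mem_univ,
      true_and, and_true]
    exact ⟨(u, u'), ⟨hu, hu'⟩, k, h1, h2, h3⟩
  calc _ ≤ (∑ uu ∈ P ×ˢ P,
        (Finset.univ.filter fun π : (Fin b ≃ Fin b) × (Fin b ≃ Fin b) =>
          ∃ k, 1 ≤ k ∧ k ≤ m ∧ (alternatingStep π.1 π.2 ^ k) uu.1 = uu.2).card * Y)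
          * (b - m) := by
        gcongr
        refine (Finset.card_le_card hsub).trans (Finset.card_biUnion_le.trans (le_of_eq ?_))
        apply Finset.sum_congr rfl
        intro uu _
        rw [Finset.card_product, Finset.card_univ]
    _ ≤ ∑ uu ∈ P ×ˢ P, m * Fintype.card (MatchingTriple P) := by
        rw [Finset.sum_mul]
        apply Finset.sum_le_sum
        intro uu _
        have h := card_hit_mul_le uu.1 uu.2 m
        rw [Fintype.card_fin] at h
        rw [Fintype.card_prod, mul_right_comm, ← mul_assoc]
        exact Nat.mul_le_mul_right Y h
    _ = _ := by
        rw [Finset.sum_const, Finset.card_product, smul_eq_mul]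
        ring

/-! ### The random gadget -/

/-- The triple of the first two full matchings and the only matching between the non-ports. -/
def firstMatchings {b m : ℕ} {P : Finset (GadgetVertex b)}
    (x : (Fin (m + 2) → (Fin b ≃ Fin b)) × (Fin 1 → (LeftNonports P ≃ RightNonports P))) :
    MatchingTriple P :=
  ((x.1 0, x.1 1), x.2 0)

/-- The matchings of a gadget, as their first triple and the remaining full matchings. -/
def matchingsEquiv {b m : ℕ} (P : Finset (GadgetVertex b)) :
    (Fin (m + 2) → (Fin b ≃ Fin b)) × (Fin 1 → (LeftNonports P ≃ RightNonports P)) ≃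
      MatchingTriple P × (Fin m → (Fin b ≃ Fin b)) where
  toFun x := (firstMatchings x, fun i => x.1 i.succ.succ)
  invFun y := (Fin.cons y.1.1.1 (Fin.cons y.1.1.2 y.2), fun _ => y.1.2)
  left_inv := by
    rintro ⟨x, z⟩
    refine Prod.ext ?_ ?_
    · funext i
      refine Fin.cases rfl (fun i => ?_) i
      refine Fin.cases rfl (fun i => rfl) i
    · funext i
      rw [Subsingleton.elim i 0]
      rfl
  right_inv := by
    rintro ⟨⟨⟨x, y⟩, z⟩, w⟩
    rfl

theorem card_filter_firstMatchings {b m : ℕ} (P : Finset (GadgetVertex b))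
    (Q : MatchingTriple P → Prop) [DecidablePred Q] :
    (Finset.univ.filter fun x : (Fin (m + 2) → (Fin b ≃ Fin b)) ×
        (Fin 1 → (LeftNonports P ≃ RightNonports P)) => Q (firstMatchings x)).card
      = (Finset.univ.filter Q).card * Fintype.card (Fin m → (Fin b ≃ Fin b)) := by
  rw [← Finset.card_univ (α := Fin m → (Fin b ≃ Fin b)), ← Finset.card_product]
  apply Finset.card_equiv (matchingsEquiv P)
  intro x
  simp [matchingsEquiv]

open Classical in
/-- An event that only depends on the ports and the first triple of matchings has probability at
least `1 - ε` if it does conditionally on each set of ports. -/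
theorem one_sub_le_gadgetProb {b p m : ℕ} [Nonempty (GadgetSample b p (m + 2) 1)] {ε : ℝ}
    (Q : ∀ P : PortSet b p, MatchingTriple P.1 → Prop)
    (hQ : ∀ P, ((Finset.univ.filter fun z => ¬ Q P z).card : ℝ)
      ≤ ε * Fintype.card (MatchingTriple P.1))
    (E : Set (GadgetSample b p (m + 2) 1)) (hE : ∀ ω, Q ω.1 (firstMatchings ω.2) → ω ∈ E) :
    1 - ε ≤ gadgetProb b p (m + 2) 1 E := by
  unfold gadgetProb
  rw [Nat.card_eq_fintype_card, Nat.card_eq_fintype_card, le_div_iff₀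
    (by exact_mod_cast Fintype.card_pos)]
  have h1 : Fintype.card (GadgetSample b p (m + 2) 1)
      ≤ Fintype.card E + (Finset.univ.filter fun ω : GadgetSample b p (m + 2) 1 =>
        ¬ Q ω.1 (firstMatchings ω.2)).card := by
    rw [← Finset.card_univ, ← Set.toFinset_card]
    refine (Finset.card_le_card ?_).trans (Finset.card_union_le _ _)
    intro ω _
    by_cases h : Q ω.1 (firstMatchings ω.2)
    · exact Finset.mem_union_left _ (by simpa using hE ω h)
    · exact Finset.mem_union_right _ (by simpa using h)
  have h2 : (Finset.univ.filter fun ω : GadgetSample b p (m + 2) 1 =>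
      ¬ Q ω.1 (firstMatchings ω.2)) = (Finset.univ : Finset (PortSet b p)).sigma fun P =>
        Finset.univ.filter fun x => ¬ Q P (firstMatchings x) := by
    ext ω
    simp
  have h3 : ((Finset.univ.filter fun ω : GadgetSample b p (m + 2) 1 =>
      ¬ Q ω.1 (firstMatchings ω.2)).card : ℝ)
      ≤ ε * Fintype.card (GadgetSample b p (m + 2) 1) := by
    rw [h2, Finset.card_sigma, Fintype.card_sigma, Nat.cast_sum, Nat.cast_sum, Finset.mul_sum]
    apply Finset.sum_le_sum
    intro P _
    rw [card_filter_firstMatchings P.1 fun z => ¬ Q P z,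
      Fintype.card_congr (matchingsEquiv (m := m) P.1), Fintype.card_prod, Nat.cast_mul,
      Nat.cast_mul, ← mul_assoc]
    gcongr
    exact hQ P
  have h4 : (Fintype.card (GadgetSample b p (m + 2) 1) : ℝ) ≤ Fintype.card E +
      (Finset.univ.filter fun ω : GadgetSample b p (m + 2) 1 =>
        ¬ Q ω.1 (firstMatchings ω.2)).card := by exact_mod_cast h1
  linarith

theorem gadgetProb_le_one {b p dIn dOut : ℕ} (E : Set (GadgetSample b p dIn dOut)) :
    gadgetProb b p dIn dOut E ≤ 1 := by
  unfold gadgetProb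
  apply div_le_one_of_le₀ _ (Nat.cast_nonneg _)
  exact_mod_cast Finite.card_subtype_le _

theorem PortSet.card_toLeft {b p : ℕ} (P : PortSet b p) : P.1.toLeft.card = p := by
  refine Eq.trans ?_ P.2.1
  apply Finset.card_bij (fun u _ => Sum.inl u)
  · intro u hu; simpa using hu
  · intro u _ v _ h; exact Sum.inl_injective h
  · rintro (u | u) hu
    · exact ⟨u, by simpa using hu, rfl⟩
    · simp at hu

theorem PortSet.card_toRight {b p : ℕ} (P : PortSet b p) : P.1.toRight.card = p := by
  refine Eq.trans ?_ P.2.2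
  apply Finset.card_bij (fun u _ => Sum.inr u)
  · intro u hu; simpa using hu
  · intro u _ v _ h; exact Sum.inr_injective h
  · rintro (u | u) hu
    · simp at hu
    · exact ⟨u, by simpa using hu, rfl⟩

theorem PortSet.card_eq {b p : ℕ} (P : PortSet b p) : P.1.card = 2 * p := by
  rw [← Finset.card_toLeft_add_card_toRight, P.card_toLeft, P.card_toRight, two_mul]

theorem PortSet.card_leftNonports {b p : ℕ} (P : PortSet b p) :
    Fintype.card (LeftNonports P.1) = b - p := by
  have h := P.card_toLeft
  rw [Fintype.card_subtype_compl, Fintype.card_fin, Fintype.card_subtype]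
  congr 1
  refine Eq.trans ?_ h
  congr 1
  ext u
  simp

theorem PortSet.card_rightNonports {b p : ℕ} (P : PortSet b p) :
    Fintype.card (RightNonports P.1) = b - p := by
  have h := P.card_toRight
  rw [Fintype.card_subtype_compl, Fintype.card_fin, Fintype.card_subtype]
  congr 1
  refine Eq.trans ?_ h
  congr 1
  ext u
  simp

theorem nonempty_gadgetSample {b p : ℕ} (hp : p ≤ b) (dIn dOut : ℕ) :
    Nonempty (GadgetSample b p dIn dOut) := by
  obtain ⟨S, -, hS⟩ := Finset.exists_subset_card_eq (s := (Finset.univ : Finset (Fin b)))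
    (n := p) (by simpa using hp)
  have e1 : ((S.disjSum S).filter fun x => x.isLeft = true) = S.map ⟨_, Sum.inl_injective⟩ := by
    ext (u | u) <;> simp
  have e2 : ((S.disjSum S).filter fun x => x.isRight = true) = S.map ⟨_, Sum.inr_injective⟩ := by
    ext (u | u) <;> simp
  let P : PortSet b p := ⟨S.disjSum S, by rw [e1, Finset.card_map, hS],
    by rw [e2, Finset.card_map, hS]⟩
  obtain ⟨e⟩ : Nonempty (LeftNonports P.1 ≃ RightNonports P.1) :=
    Fintype.card_eq.1 (P.card_leftNonports.trans P.card_rightNonports.symm)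
  exact ⟨⟨P, fun _ => Equiv.refl _, fun _ => e⟩⟩

namespace GadgetSample

variable {b p dIn dOut : ℕ}

theorem adj_of_inner (ω : GadgetSample b p dIn dOut) (i : Fin dIn) (u : Fin b) :
    ω.graph.Adj (Sum.inl u) (Sum.inr (ω.2.1 i u)) := by
  rw [GadgetSample.graph, SimpleGraph.fromRel_adj]
  exact ⟨by simp, Or.inl ⟨u, _, rfl, rfl, Or.inl ⟨i, rfl⟩⟩⟩

theorem adj_of_outer (ω : GadgetSample b p dIn dOut) (i : Fin dOut)
    (u : LeftNonports ω.ports) :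
    ω.graph.Adj (Sum.inl u.1) (Sum.inr (ω.2.2 i u).1) := by
  rw [GadgetSample.graph, SimpleGraph.fromRel_adj]
  exact ⟨by simp, Or.inl ⟨u.1, _, rfl, rfl, Or.inr ⟨i, u.2, rfl⟩⟩⟩

end GadgetSample

open Classical in
/-- With high probability the first three matchings already make the gadget a port expander, with
an absolute constant: `7200 = 6 * N` for `N = 1200`, with ports separated by `2 * (4 * N) = 9600`
steps. -/
theorem exists_one_sub_le_gadgetProb_isPortExpander : ∃ K : ℝ, 0 ≤ K ∧ ∀ b p dIn : ℕ, 2 ≤ dIn →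
    80 * p ≤ b → 19200 ≤ b → ∀ E : Set (GadgetSample b p dIn 1),
      (∀ ω, IsPortExpander ω.graph ω.ports (1 / 7200) → ω ∈ E) →
        1 - (K + 76800 * (p : ℝ) ^ 2) / b ≤ gadgetProb b p dIn 1 E := by
  obtain ⟨K, hK0, hK⟩ := exists_card_not_areMixing_le
  refine ⟨K, hK0, fun b p dIn hdIn hpb hb E hE => ?_⟩
  obtain ⟨m, rfl⟩ : ∃ m, dIn = m + 2 := ⟨dIn - 2, by omega⟩
  have := nonempty_gadgetSample (b := b) (p := p) (by omega) (m + 2) 1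
  apply one_sub_le_gadgetProb (fun P z => AreMixing 1200 z.1.1 z.1.2 z.2 ∧
    ArePortsSeparated 9600 P.1 z.1.1 z.1.2)
  · intro P
    set T := Fintype.card (MatchingTriple P.1) with hT
    have h1 := hK b P.1 (by rw [P.card_rightNonports]; omega)
    have h2 := card_not_arePortsSeparated_mul_le 9600 P.1
    rw [← hT] at h1 h2
    rw [P.card_eq] at h2
    have hbpos : (0 : ℝ) < b := by
      have : 0 < b := by omega
      exact_mod_cast this
    have h3 : (((Finset.univ.filter fun z : MatchingTriple P.1 =>
        ¬ ArePortsSeparated 9600 P.1 z.1.1 z.1.2).card : ℕ) : ℝ)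
        ≤ 76800 * (p : ℝ) ^ 2 / b * T := by
      rw [div_mul_eq_mul_div, le_div_iff₀ hbpos]
      have h4 : (Finset.univ.filter fun z : MatchingTriple P.1 =>
        ¬ ArePortsSeparated 9600 P.1 z.1.1 z.1.2).card * b ≤ 76800 * p ^ 2 * T := by
        have h5 : b ≤ 2 * (b - 9600) := by omega
        calc _ ≤ _ * (2 * (b - 9600)) := Nat.mul_le_mul_left _ h5
          _ = 2 * (_ * (b - 9600)) := by ring
          _ ≤ 2 * ((2 * p) ^ 2 * 9600 * T) := Nat.mul_le_mul_left _ h2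
          _ = _ := by ring
      exact_mod_cast h4
    rw [add_div, add_mul]
    refine le_trans ?_ (add_le_add h1 h3)
    rw [← Nat.cast_add]
    refine Nat.cast_le.2 (le_trans (Finset.card_le_card ?_) (Finset.card_union_le _ _))
    intro z hz
    simp only [Finset.mem_union, Finset.mem_filter, Finset.mem_univ, true_and] at hz ⊢
    exact not_and_or.1 hz
  · rintro ω ⟨h1, h2⟩
    apply hE
    have h := isPortExpander_of_areMixing (G := ω.graph) (P := ω.ports) (by norm_num)
      (ω.adj_of_inner 0) (ω.adj_of_inner 1) (ω.adj_of_outer 0) h1 h2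
    norm_num at h
    norm_num
    exact h

theorem natFloor_rpow_sq_le_sqrt {α : ℝ} (hα : α ≤ 1 / 4) {b : ℕ} (hb : 1 ≤ b) :
    (⌊(b : ℝ) ^ α⌋₊ : ℝ) ^ 2 ≤ √b := by
  have hb' : (1 : ℝ) ≤ b := by exact_mod_cast hb
  have h1 : (⌊(b : ℝ) ^ α⌋₊ : ℝ) ≤ (b : ℝ) ^ (1 / 4 : ℝ) :=
    (Nat.floor_le (by positivity)).trans (Real.rpow_le_rpow_of_exponent_le hb' hα)
  calc (⌊(b : ℝ) ^ α⌋₊ : ℝ) ^ 2 ≤ ((b : ℝ) ^ (1 / 4 : ℝ)) ^ 2 := by gcongr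
    _ = √b := by
      rw [← Real.rpow_natCast, ← Real.rpow_mul (by positivity), Real.sqrt_eq_rpow]
      norm_num

theorem mainTheorem10 (α : ℝ) (hα0 : 0 < α) (hα : α ≤ 1 / 4) (D : ℕ) :
    ∃ δ : ℝ, 0 < δ ∧ ∀ d : ℕ → ℕ, (∀ b, 3 ≤ d b ∧ d b ≤ D) →
      Tendsto (fun b : ℕ => gadgetProb b ⌊(b : ℝ) ^ α⌋₊ (d b - 1) 1
        {ω | ∀ (q : ℕ) (W : Type) [Fintype W] (βB h : ℝ) (κ : Fin q)
            (M : PottsModel (GadgetVertex b ⊕ W) q),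
            0 < βB → IsHostModel ω.graph ω.ports 1 βB h κ M → ∀ τ : W → Fin q,
              (max 0 (1 - (q : ℝ) ^ 2 * Real.exp (2 * |h|) / Real.exp (δ * βB * (d b : ℝ))))
                  ^ (2 * b)
                ≤ M.condGibbs {σ | ∃ i : Fin q, ∀ x, σ (Sum.inl x) = i}
                    {σ | ∀ w, σ (Sum.inr w) = τ w}})
        atTop (𝓝 1) := by
  obtain ⟨K, hK0, hK⟩ := exists_one_sub_le_gadgetProb_isPortExpander
  -- a quarter of the expansion constant `1 / 7200`, spread over the at most `D` edges of a vertex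
  refine ⟨1 / 28800 / (D + 1), by positivity, fun d hd => ?_⟩
  have hlim : Tendsto (fun b : ℕ => 1 - (K / b + 76800 / √(b : ℝ))) atTop (𝓝 1) := by
    have h1 : Tendsto (fun b : ℕ => K / (b : ℝ)) atTop (𝓝 0) :=
      tendsto_const_nhds.div_atTop tendsto_natCast_atTop_atTop
    have h2 : Tendsto (fun b : ℕ => 76800 / √(b : ℝ)) atTop (𝓝 0) :=
      tendsto_const_nhds.div_atTop (Real.tendsto_sqrt_atTop.comp tendsto_natCast_atTop_atTop)
    simpa using tendsto_const_nhds (x := (1 : ℝ)).sub (h1.add h2)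
  refine tendsto_of_tendsto_of_tendsto_of_le_of_le' hlim tendsto_const_nhds ?_
    (Eventually.of_forall fun b => gadgetProb_le_one _)
  filter_upwards [eventually_ge_atTop (28800 ^ 2)] with b hb
  set p := ⌊(b : ℝ) ^ α⌋₊ with hp
  have hp2 : (p : ℝ) ^ 2 ≤ √b := natFloor_rpow_sq_le_sqrt hα (by omega)
  have hbR : (28800 : ℝ) ^ 2 ≤ b := by exact_mod_cast hb
  have hsqrt : 28800 ≤ √(b : ℝ) := Real.le_sqrt_of_sq_le hbR
  have hss : √(b : ℝ) * √b = b := Real.mul_self_sqrt (by positivity)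
  have hpb : 28800 * p ≤ b := by
    have h1 : p ≤ p ^ 2 := Nat.le_self_pow two_ne_zero p
    have h2 : (p : ℝ) ≤ (p : ℝ) ^ 2 := by exact_mod_cast h1
    have h3 : (28800 : ℝ) * p ≤ b := by nlinarith
    exact_mod_cast h3
  have hdb := hd b
  refine le_trans ?_ (hK b p (d b - 1) (by omega) (by omega) (by omega) _ ?_)
  · have h1 : 76800 * (p : ℝ) ^ 2 / b ≤ 76800 / √b := by
      rw [div_le_div_iff₀ (by positivity) (by positivity)]
      nlinarith
    rw [add_div]
    linarith
  · intro ω hω q W _ β h κ M hβ hM τ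
    have : Nonempty (GadgetVertex b) := ⟨Sum.inl ⟨0, by omega⟩⟩
    have hcard : Fintype.card (GadgetVertex b) = 2 * b := by
      rw [Fintype.card_sum, Fintype.card_fin, two_mul]
    have hports : 4 * (ω.ports.card : ℝ) ≤ 1 / 7200 * Fintype.card (GadgetVertex b) := by
      rw [hcard, show ω.ports.card = 2 * p from ω.1.card_eq]
      have : (28800 : ℝ) * p ≤ b := by exact_mod_cast hpb
      push_cast
      linarith
    have hq : (1 : ℝ) ≤ q := by exact_mod_cast κ.pos
    rw [← hcard]
    refine hM.condGibbs_ge hβ hω (by norm_num) hports τ ?_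
    rw [mul_div_assoc, ← Real.exp_sub]
    refine mul_le_mul (by nlinarith) (Real.exp_le_exp.mpr ?_) (Real.exp_pos _).le (by positivity)
    have hdD : (d b : ℝ) ≤ D + 1 := by
      have : (d b : ℝ) ≤ D := by exact_mod_cast hdb.2
      linarith
    have hδ : 1 / 28800 / ((D : ℝ) + 1) * β * d b ≤ β * (1 / 28800) := by
      rw [div_mul_eq_mul_div, div_mul_eq_mul_div, div_le_iff₀ (by positivity)]
      nlinarith
    linarith [abs_nonneg h]
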